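/- Let $k$ be a field, $H$ a Hopf algebra over $k$ with bijective antipode, and $X$ a topological space. All algebras are associative and unital $k$-algebras, and $\otimes=\otimes_k$. **Definitions.** For a right $H$-comodule algebra $(P,\delta)$ put $P^{co(H)}=\{p : \delta(p)=p\otimes 1\}$. It is an *$H$-Hopf–Galois extension* of $P^{co(H)}$ if $\chi: P\otimes_{P^{co(H)}}P\to P\otimes H$, $p'\otimes p\mapsto p'p_{(0)}\otimes p_{(1)}$, is bijective, and it is *cleft* if there is a right $H$-colinear map $\gamma:H\to P$ that is invertible for the convolution product. A *sheaf of $H$-comodule algebras* is a sheaf of algebras $\mathcal P$ on $X$ with a right $H$-comodule algebra structure on each $\mathcal P(V)$ such that the restriction maps are $H$-colinear. It is a *sheaf of $H$-Hopf–Galois extensions* if moreover every $\mathcal P(V)$ is an $H$-Hopf–Galois extension of $\mathcal P(V)^{co(H)}$, and it is *locally cleft* if $X$ has an open covering $(U_i)$ such that every $\mathcal P(U_i)$ is cleft. A sheaf is *flabby* if all its restriction maps are surjective. A *(Pflaum) quantum principal bundle* over $X$ with structure group $H$, trivialized over an open covering $(U_i)_{i\in I}$ of $X$, consists of two sheaves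 of algebras $\mathcal M$ (base) and $\mathcal P$ (total space) on $X$, a morphism of sheaves of algebras $\sigma:\mathcal M\to\mathcal P$ that is injective on sections, and for each $i\in I$: - crossed product structures $\mathcal M(V)\#_i H$ for all open $V\subseteq U_i$, compatible with restrictions, where a crossed product structure on an algebra $A$ is a measuring $H\otimes A\to A$ and a normalized, convolution invertible $2$-cocycle $H\otimes H\to A$ that make $A$ a twisted $H$-module, and $A\#H$ is $A\otimes H$ with the resulting product; - algebra isomorphisms $\Omega_{i,V}:\mathcal M(V)\#_i H\to\mathcal P(V)$ for all open $V\subseteq U_i$, compatible with restrictions, with $\Omega_{i,V}(f\otimes 1)=\sigma_V(f)$; such that for all $i,j\in I$ and all open $V\subseteq U_i\cap U_j$ the map $\Omega_{ij}=\Omega_{i,V}^{-1}\circ\Omega_{j,V}$ satisfies $(\Omega_{ij}\otimes \mathrm{id})(\mathrm{id}\otimes\Delta)=(\mathrm{id}\otimes\Delta)\,\Omega_{ij}$. An $H$-coaction on $\mathcal P$ is *principal* for the bundle if it equals $(\Omega_{i,V}\otimes \mathrm{id})(\mathrm{id}\otimes\Delta)\,\Omega_{i,V}^{-1}$ on $\mathcal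 P(V)$ for all $i\in I$ and all open $V\subseteq U_i$. **Proposition.** 1. Let $\mathcal P$ be the total space of a quantum principal bundle over $X$ with structure group $H$, trivialized over an open covering $(U_i)_{i\in I}$ that has a finite subcovering. If $\mathcal P$ is flabby, then $\mathcal P$ carries a principal coaction making it a sheaf of $H$-comodule algebras, and with this coaction $\mathcal P$ is a locally cleft sheaf of $H$-Hopf–Galois extensions. 2. Conversely, let $\mathcal P$ be a locally cleft sheaf of $H$-Hopf–Galois extensions over $X$. Then $\mathcal P$ is the total space of a quantum principal bundle over $X$ with structure group $H$, trivialized over some open covering of $X$, whose principal coaction is the given one and for which $\sigma$ identifies the base $\mathcal M$ with the subsheaf of coinvariants $\mathcal P^{co(H)}$. -/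

import Mathlib

open scoped TensorProduct
open CategoryTheory TopologicalSpace Opposite

universe u v w t

noncomputable section

namespace QPB

section Algebra

variable (k : Type v) [Field k] (H : Type w) [Ring H] [HopfAlgebra k H]

/-- A right `H`-coaction on the algebra `P` which is an algebra morphism, that is, the structure
of a right `H`-comodule algebra on `P`. -/
structure Coaction (P : Type u) [Ring P] [Algebra k P] where
  /-- The coaction `δ : P → P ⊗ H`, `p ↦ p₀ ⊗ p₁`. -/
  δ : P →ₐ[k] P ⊗[k] H
  coassoc : ∀ p : P, TensorProduct.assoc k P H H (δ.toLinearMap.rTensor H (δ p)) =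
    (Coalgebra.comul (R := k) (A := H)).lTensor P (δ p)
  counit : ∀ p : P, TensorProduct.rid k P
    ((Coalgebra.counit (R := k) (A := H)).lTensor P (δ p)) = p

namespace Coaction

variable {k H} {P : Type u} [Ring P] [Algebra k P] (c : Coaction k H P)

/-- The subalgebra of coinvariants `{p | δ p = p ⊗ 1}`. -/
def coinvariants : Subalgebra k P :=
  AlgHom.equalizer c.δ (Algebra.TensorProduct.includeLeft : P →ₐ[k] P ⊗[k] H)

/-- The subspace of `P ⊗ P` spanned by the `p' b ⊗ p - p' ⊗ b p` with `b` coinvariant. -/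
def balancing : Submodule k (P ⊗[k] P) :=
  Submodule.span k {z | ∃ p' p b : P, b ∈ c.coinvariants ∧
    z = (p' * b) ⊗ₜ[k] p - p' ⊗ₜ[k] (b * p)}

/-- The tensor product `P ⊗_B P` over the (not necessarily commutative) subalgebra `B` of
coinvariants. -/
abbrev BalancedTensor : Type _ := (P ⊗[k] P) ⧸ c.balancing

/-- The lifted canonical map `P ⊗ P → P ⊗ H`, `p' ⊗ p ↦ p' p₀ ⊗ p₁`. -/
def canLift : P ⊗[k] P →ₗ[k] P ⊗[k] H :=
  LinearMap.mul' k (P ⊗[k] H) ∘ₗ TensorProduct.map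
    (Algebra.TensorProduct.includeLeft : P →ₐ[k] P ⊗[k] H).toLinearMap c.δ.toLinearMap

theorem canLift_tmul (p' p : P) : c.canLift (p' ⊗ₜ[k] p) = (p' ⊗ₜ[k] (1 : H)) * c.δ p := by
  simp [canLift]

theorem balancing_le_ker : c.balancing ≤ LinearMap.ker c.canLift := by
  refine Submodule.span_le.2 ?_
  rintro _ ⟨p', p, b, hb, rfl⟩
  have hb' : c.δ b = b ⊗ₜ[k] (1 : H) := hb
  simp [canLift_tmul, hb', ← mul_assoc]

/-- The canonical map `χ : P ⊗_B P → P ⊗ H`. -/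
def can : c.BalancedTensor →ₗ[k] P ⊗[k] H :=
  c.balancing.liftQ c.canLift c.balancing_le_ker

/-- `P` is an `H`-Hopf–Galois extension of its coinvariants. -/
def IsHopfGalois : Prop := Function.Bijective c.can

/-- `P` is a cleft extension of its coinvariants: there is a cleaving map, that is, a right
`H`-colinear map `γ : H → P` that is invertible for the convolution product. -/
def IsCleft : Prop :=
  ∃ γ : H →ₗ[k] P,
    (∀ h : H, c.δ (γ h) = γ.rTensor H (Coalgebra.comul (R := k) h)) ∧
    IsUnit (WithConv.toConv γ)

end Coaction

/-- The data of a crossed product of `A` with `H`: a measuring `h ⊗ a ↦ h · a` of `A` by `H` and a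
convolution invertible map `coc : H ⊗ H → A`, such that `A` is a twisted `H`-module and `coc` is
a normalized `2`-cocycle. Products of maps wrapped in `WithConv.toConv` are convolution
products. -/
structure CrossedSystem (A : Type u) [Ring A] [Algebra k A] where
  /-- The measuring `h · a`. -/
  act : H →ₗ[k] A →ₗ[k] A
  /-- The cocycle. -/
  coc : H ⊗[k] H →ₗ[k] A
  /-- `h · 1 = ε(h) 1`. -/
  act_one : ∀ h : H, act h 1 = algebraMap k A (Coalgebra.counit (R := k) h)
  /-- `h · (a b) = (h₁ · a) (h₂ · b)`. -/
  act_mul : ∀ a b : A, WithConv.toConv (act.flip (a * b)) =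
    WithConv.toConv (act.flip a) * WithConv.toConv (act.flip b)
  /-- The cocycle is convolution invertible. -/
  isUnit_coc : IsUnit (WithConv.toConv coc)
  /-- `1 · a = a`. -/
  one_act : ∀ a : A, act 1 a = a
  /-- `(h₁ · (l₁ · a)) coc(h₂, l₂) = coc(h₁, l₁) ((h₂ l₂) · a)`. -/
  act_act : ∀ a : A,
    WithConv.toConv (TensorProduct.lift act ∘ₗ (act.flip a).lTensor H) * WithConv.toConv coc =
      WithConv.toConv coc * WithConv.toConv (act.flip a ∘ₗ LinearMap.mul' k H)
  /-- `coc(h, 1) = ε(h) 1`. -/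
  coc_one : ∀ h : H, coc (h ⊗ₜ[k] 1) = algebraMap k A (Coalgebra.counit (R := k) h)
  /-- `coc(1, h) = ε(h) 1`. -/
  one_coc : ∀ h : H, coc (1 ⊗ₜ[k] h) = algebraMap k A (Coalgebra.counit (R := k) h)
  /-- `(h₁ · coc(l₁, m₁)) coc(h₂, l₂ m₂) = coc(h₁, l₁) coc(h₂ l₂, m)`. -/
  cocycle :
    WithConv.toConv (TensorProduct.lift act ∘ₗ coc.lTensor H) *
        WithConv.toConv (coc ∘ₗ (LinearMap.mul' k H).lTensor H) =
      WithConv.toConv (coc ∘ₗ ((TensorProduct.rid k H).toLinearMap ∘ₗ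
          (Coalgebra.counit (R := k) (A := H)).lTensor H).lTensor H) *
        WithConv.toConv (coc ∘ₗ (LinearMap.mul' k H).rTensor H ∘ₗ
          (TensorProduct.assoc k H H H).symm.toLinearMap)

namespace CrossedSystem

variable {k H} {A : Type u} [Ring A] [Algebra k A] (s : CrossedSystem k H A)

/-- `h ⊗ b ↦ (h₁ · b) ⊗ h₂`. -/
def swap : H ⊗[k] A →ₗ[k] A ⊗[k] H :=
  (TensorProduct.lift s.act).rTensor H ∘ₗ (TensorProduct.rightComm k H H A).toLinearMap ∘ₗ
    (Coalgebra.comul (R := k) (A := H)).rTensor A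

/-- `h ⊗ l ↦ coc(h₁, l₁) ⊗ h₂ l₂`. -/
def twist : H ⊗[k] H →ₗ[k] A ⊗[k] H :=
  TensorProduct.map s.coc (LinearMap.mul' k H) ∘ₗ Coalgebra.comul (R := k) (A := H ⊗[k] H)

/-- The multiplication of the crossed product, whose underlying space is `A ⊗ H`:
`(a ⊗ h) (b ⊗ l) = a (h₁ · b) coc(h₂, l₁) ⊗ h₃ l₂`. -/
def mul : (A ⊗[k] H) ⊗[k] (A ⊗[k] H) →ₗ[k] A ⊗[k] H :=
  (LinearMap.mul' k A).rTensor H ∘ₗ (TensorProduct.assoc k A A H).symm.toLinearMap ∘ₗ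
    TensorProduct.map (LinearMap.mul' k A) s.twist ∘ₗ
    (TensorProduct.assoc k A A (H ⊗[k] H)).symm.toLinearMap ∘ₗ
    ((TensorProduct.assoc k A H H).toLinearMap ∘ₗ s.swap.rTensor H ∘ₗ
      (TensorProduct.assoc k H A H).symm.toLinearMap).lTensor A ∘ₗ
    (TensorProduct.assoc k A H (A ⊗[k] H)).toLinearMap

end CrossedSystem

/-- The coaction `id ⊗ Δ` of `H` on `A ⊗ H`. -/
def freeCoaction (A : Type u) [Ring A] [Algebra k A] : A ⊗[k] H →ₗ[k] (A ⊗[k] H) ⊗[k] H :=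
  (TensorProduct.assoc k A H H).symm.toLinearMap ∘ₗ
    (Coalgebra.comul (R := k) (A := H)).lTensor A

end Algebra

section Sheaves

variable {k : Type v} [Field k] {X : TopCat.{u}}

/-- The algebra of sections of `F` over `V`. -/
abbrev Sec (F : X.Sheaf (AlgCat.{u} k)) (V : Opens X) : Type u := F.presheaf.obj (op V)

/-- The restriction map `F(V) → F(W)` for `W ⊆ V`. -/
def res (F : X.Sheaf (AlgCat.{u} k)) {V W : Opens X} (h : W ≤ V) : Sec F V →ₐ[k] Sec F W :=
  (F.presheaf.map (homOfLE h).op).hom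

/-- The map on sections over `V` of a morphism of sheaves of algebras. -/
def onSec {F G : X.Sheaf (AlgCat.{u} k)} (f : F ⟶ G) (V : Opens X) : Sec F V →ₐ[k] Sec G V :=
  (f.1.app (op V)).hom

/-- A sheaf is flabby if its restriction maps are surjective. -/
def IsFlabby (F : X.Sheaf (AlgCat.{u} k)) : Prop :=
  ∀ ⦃V W : Opens X⦄ (h : W ≤ V), Function.Surjective (res F h)

/-- The structure of a sheaf of right `H`-comodule algebras on a sheaf of algebras `F`. -/
structure SheafCoaction (H : Type w) [Ring H] [HopfAlgebra k H]
    (F : X.Sheaf (AlgCat.{u} k)) where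
  /-- The right `H`-comodule algebra structure on the sections over `V`. -/
  on : ∀ V : Opens X, Coaction k H (Sec F V)
  /-- The restriction maps are morphisms of `H`-comodule algebras. -/
  res_δ : ∀ ⦃V W : Opens X⦄ (h : W ≤ V) (p : Sec F V),
    (on W).δ (res F h p) = (res F h).toLinearMap.rTensor H ((on V).δ p)

namespace SheafCoaction

variable {H : Type w} [Ring H] [HopfAlgebra k H] {F : X.Sheaf (AlgCat.{u} k)}

/-- `F` is a sheaf of `H`-Hopf–Galois extensions. -/
def IsHopfGalois (c : SheafCoaction H F) : Prop := ∀ V : Opens X, (c.on V).IsHopfGalois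

/-- `F` is locally cleft. -/
def IsLocallyCleft (c : SheafCoaction H F) : Prop :=
  ∃ (ι : Type u) (U : ι → Opens X), iSup U = ⊤ ∧ ∀ i, (c.on (U i)).IsCleft

end SheafCoaction

/-- A quantum principal bundle over `X` with total quantum space `P`, base quantum space `M` and
structure group `H`, trivialized over the open covering `(U i)`. -/
structure QuantumPrincipalBundle (H : Type w) [Ring H] [HopfAlgebra k H]
    (M P : X.Sheaf (AlgCat.{u} k)) {ι : Type t} (U : ι → Opens X) where
  cover : iSup U = ⊤
  /-- The morphism `σ : M → P`; the sequence `0 → M → P` is exact. -/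
  σ : M ⟶ P
  σ_injective : ∀ V : Opens X, Function.Injective (onSec σ V)
  /-- The crossed product structure on `M` restricted to `U i`, given on sections over each
  open `V ⊆ U i`. -/
  cross : ∀ (i : ι) (V : Opens X), V ≤ U i → CrossedSystem k H (Sec M V)
  res_act : ∀ (i : ι) ⦃V W : Opens X⦄ (hV : V ≤ U i) (hWV : W ≤ V) (h : H) (f : Sec M V),
    res M hWV ((cross i V hV).act h f) = (cross i W (hWV.trans hV)).act h (res M hWV f)
  res_coc : ∀ (i : ι) ⦃V W : Opens X⦄ (hV : V ≤ U i) (hWV : W ≤ V) (x : H ⊗[k] H),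
    res M hWV ((cross i V hV).coc x) = (cross i W (hWV.trans hV)).coc x
  /-- The local trivializations: isomorphisms, natural in `V ⊆ U i`, from the crossed product
  `M(V) #ᵢ H` (with underlying space `M(V) ⊗ H`) to `P(V)`. -/
  Ω : ∀ (i : ι) (V : Opens X), V ≤ U i → (Sec M V ⊗[k] H) ≃ₗ[k] Sec P V
  res_Ω : ∀ (i : ι) ⦃V W : Opens X⦄ (hV : V ≤ U i) (hWV : W ≤ V) (x : Sec M V ⊗[k] H),
    res P hWV (Ω i V hV x) = Ω i W (hWV.trans hV) ((res M hWV).toLinearMap.rTensor H x)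
  Ω_mul : ∀ (i : ι) (V : Opens X) (hV : V ≤ U i) (x y : Sec M V ⊗[k] H),
    Ω i V hV ((cross i V hV).mul (x ⊗ₜ[k] y)) = Ω i V hV x * Ω i V hV y
  /-- `Ωᵢ (f ⊗ 1) = σ f`; in particular `Ωᵢ` is unital. -/
  Ω_tmul_one : ∀ (i : ι) (V : Opens X) (hV : V ≤ U i) (f : Sec M V),
    Ω i V hV (f ⊗ₜ[k] 1) = onSec σ V f
  /-- The coordinate changes `Ωᵢⱼ = Ωᵢ⁻¹ ∘ Ωⱼ` satisfy `(Ωᵢⱼ ⊗ id)(id ⊗ Δ) = (id ⊗ Δ) Ωᵢⱼ`. -/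
  Ω_colinear : ∀ (i j : ι) (V : Opens X) (hi : V ≤ U i) (hj : V ≤ U j) (x : Sec M V ⊗[k] H),
    ((Ω j V hj).trans (Ω i V hi).symm).toLinearMap.rTensor H (freeCoaction k H (Sec M V) x) =
      freeCoaction k H (Sec M V) (((Ω j V hj).trans (Ω i V hi).symm) x)

/-- `c` is the principal coaction of the quantum principal bundle `Q`: on sections over
`V ⊆ U i` it is `(Ωᵢ ⊗ id)(id ⊗ Δ) Ωᵢ⁻¹`. -/
def QuantumPrincipalBundle.IsPrincipalCoaction {H : Type w} [Ring H] [HopfAlgebra k H]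
    {M P : X.Sheaf (AlgCat.{u} k)} {ι : Type t} {U : ι → Opens X}
    (Q : QuantumPrincipalBundle H M P U) (c : SheafCoaction H P) : Prop :=
  ∀ (i : ι) (V : Opens X) (hV : V ≤ U i) (p : Sec P V),
    (c.on V).δ p = (Q.Ω i V hV).toLinearMap.rTensor H
      (freeCoaction k H (Sec M V) ((Q.Ω i V hV).symm p))

end Sheaves

end QPB

end

/-!
Throughout, the convolution algebras `Hom(C, A)` do the bookkeeping of Sweedler indices. Algebra
morphisms `A → B` and coalgebra morphisms `D → C` induce ring morphisms between them (`convMap`,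
`convComap`), and a map `γ : H → P` is colinear iff `δ ∘ γ` is the convolution product of
`h ↦ γ(h) ⊗ 1` and `h ↦ 1 ⊗ h` (`Coaction.isColinear_iff`). Most identities about crossed products
thereby become short computations in a noncommutative ring.

**Cleft extensions and crossed products.** A normalized cleaving map `γ` on `P` turns the
coinvariants `A` into a twisted `H`-module, with `h · a = γ(h₁) a γ⁻¹(h₂)` and cocycle
`γ(h₁) γ(l₁) γ⁻¹(h₂ l₂)`, and `a ⊗ h ↦ a γ(h)` is an isomorphism `A # H → P`
(`Coaction.exists_isTrivialization`). Conversely, for an isomorphism `Ω : A # H → P` extending `σ`,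
the coaction `id ⊗ Δ` of `A ⊗ H` is transported to an algebra morphism `P → P ⊗ H`
(`CrossedSystem.IsTrivialization.coaction`), and `γ(h) = Ω(1 ⊗ h)` is colinear. It is convolution
invertible: an element `f` of `Hom(C, R)` is a unit iff `a ⊗ x ↦ a f(x₁) ⊗ x₂` is bijective on
`R ⊗ C`, and the identity `γ(h) γ(l) = coc(h₁, l₁) γ(h₂ l₂)` expresses this map for `γ` through the
bijective one for the cocycle (`CrossedSystem.IsTrivialization.isCleft_coaction`). In particular,
no inverse of the antipode is needed here.

**From a bundle to Hopf–Galois extensions.** The local coactions of a quantum principal bundle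
agree on overlaps because the coordinate changes are colinear. As `H` may be infinite dimensional,
`V ↦ F(V) ⊗ H` is only separated, but sections do glue over finite coverings
(`exists_tensor_eq`); this gives the principal coaction (`exists_sheafCoaction`). Over a general
open set cleaving maps need not exist; the weaker property that passes from `V₁` and `V₂` to
`V₁ ∪ V₂` is the existence of a *total integral*, a colinear map `j : H → P` with `j(1) = 1`,
together with the surjectivity of the canonical map. A total integral makes `P` a colinear
retract of the free comodule `P ⊗ H`, so that over a flabby sheaf the difference of two total
integrals on `V₁ ∩ V₂` lifts to a colinear map on `V₁`, by which the first one is corrected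
(`Coaction.IsTotalIntegral.exists_of_pullback`). Finally, for bijective antipode, a total integral
and surjectivity of the canonical map force the latter to be injective
(`Coaction.IsTotalIntegral.isHopfGalois`).

**From Hopf–Galois extensions to a bundle.** The coinvariants form a sheaf of algebras, and the
restrictions of cleaving maps over the members of the covering provide crossed product structures
and trivializations that are compatible with restrictions, since they are given by formulas in
`γ` and `γ⁻¹` (`SheafCoaction.exists_quantumPrincipalBundle`).
-/

noncomputable section

namespace QPB

/-! ### Convolution algebras -/

section Convolution

open WithConv Coalgebra

variable {k : Type*} [Field k]
variable {A B : Type*} [Ring A] [Algebra k A] [Ring B] [Algebra k B]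
variable {C D : Type*} [AddCommMonoid C] [Module k C] [Coalgebra k C]
  [AddCommMonoid D] [Module k D] [Coalgebra k D]

theorem sum_counit_left_smul {M : Type*} [AddCommGroup M] [Module k M] (f : C →ₗ[k] M) (c : C) :
    ∑ i ∈ (ℛ k c).index, counit (R := k) ((ℛ k c).left i) • f ((ℛ k c).right i) = f c := by
  simp only [← map_smul]
  rw [← map_sum, sum_counit_smul]

theorem sum_counit_right_smul {M : Type*} [AddCommGroup M] [Module k M] (f : C →ₗ[k] M) (c : C) :
    ∑ i ∈ (ℛ k c).index, counit (R := k) ((ℛ k c).right i) • f ((ℛ k c).left i) = f c := by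
  have h := congrArg (TensorProduct.rid k M) (sum_map_tmul_counit_eq f c (repr := ℛ k c))
  rw [map_sum] at h
  simpa only [TensorProduct.rid_tmul, one_smul] using h

/-- Composition with an algebra morphism `A → B` as a morphism `Hom(C, A) → Hom(C, B)` of
convolution algebras. -/
def convMap (C : Type*) [AddCommMonoid C] [Module k C] [Coalgebra k C] (θ : A →ₐ[k] B) :
    WithConv (C →ₗ[k] A) →+* WithConv (C →ₗ[k] B) where
  toFun f := toConv (θ.toLinearMap ∘ₗ f.ofConv)
  map_one' := by ext c; simp
  map_mul' f g := WithConv.ext (LinearMap.algHom_comp_convMul_distrib θ f g)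
  map_zero' := by ext c; simp
  map_add' f g := by ext c; simp

@[simp] theorem convMap_apply (θ : A →ₐ[k] B) (f : WithConv (C →ₗ[k] A)) (c : C) :
    (convMap C θ f) c = θ (f c) := rfl

/-- Composition with a coalgebra morphism `D → C` as a morphism `Hom(C, A) → Hom(D, A)` of
convolution algebras. -/
def convComap (A : Type*) [Ring A] [Algebra k A] (g : D →ₗc[k] C) :
    WithConv (C →ₗ[k] A) →+* WithConv (D →ₗ[k] A) where
  toFun f := toConv (f.ofConv ∘ₗ g.toLinearMap)
  map_one' := by ext c; simp
  map_mul' f f' := WithConv.ext (LinearMap.convMul_comp_coalgHom_distrib f f' g)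
  map_zero' := by ext c; simp
  map_add' f g := by ext c; simp

@[simp] theorem convComap_apply (g : D →ₗc[k] C) (f : WithConv (C →ₗ[k] A)) (d : D) :
    (convComap A g f) d = f (g d) := rfl

/-- The elements of `A` as elements `c ↦ ε(c) a` of the convolution algebra `Hom(C, A)`. -/
def convConst (k : Type*) [Field k] {A : Type*} [Ring A] [Algebra k A]
    (C : Type*) [AddCommMonoid C] [Module k C] [Coalgebra k C] :
    A →+* WithConv (C →ₗ[k] A) where
  toFun a := toConv (LinearMap.toSpanSingleton k A a ∘ₗ counit)
  map_one' := by ext c; simp [Algebra.algebraMap_eq_smul_one]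
  map_mul' a b := by
    ext c
    rw [(ℛ k c).convMul_apply]
    simp only [LinearMap.comp_apply, LinearMap.toSpanSingleton_apply, smul_mul_smul_comm]
    rw [← Finset.sum_smul]
    exact congrArg (· • (a * b)) (sum_counit_left_smul (counit (R := k)) c).symm
  map_zero' := by ext c; simp
  map_add' a b := by ext c; simp

@[simp] theorem convConst_apply (a : A) (c : C) :
    (convConst k C a) c = counit (R := k) c • a := rfl

theorem convMap_convConst (θ : A →ₐ[k] B) (a : A) :
    convMap C θ (convConst k C a) = convConst k C (θ a) := by
  ext c; simp

theorem convComap_convConst (g : D →ₗc[k] C) (a : A) :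
    convComap A g (convConst k C a) = convConst k D a := by
  ext c; simp

theorem convMap_convComap (θ : A →ₐ[k] B) (g : D →ₗc[k] C) (f : WithConv (C →ₗ[k] A)) :
    convMap D θ (convComap A g f) = convComap B g (convMap C θ f) := rfl

theorem convConst_mul_apply (a : A) (f : WithConv (C →ₗ[k] A)) (c : C) :
    (convConst k C a * f) c = a * f c := by
  rw [(ℛ k c).convMul_apply]
  simp only [convConst_apply, smul_mul_assoc, ← mul_smul_comm]
  rw [← Finset.mul_sum, sum_counit_left_smul f.ofConv c]

theorem mul_convConst_apply (a : A) (f : WithConv (C →ₗ[k] A)) (c : C) :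
    (f * convConst k C a) c = f c * a := by
  rw [(ℛ k c).convMul_apply]
  simp only [convConst_apply, mul_smul_comm, ← smul_mul_assoc]
  rw [← Finset.sum_mul, sum_counit_right_smul f.ofConv c]

theorem convMap_injective (θ : A →ₐ[k] B) (hθ : Function.Injective θ) :
    Function.Injective (convMap C θ) := by
  intro f g h
  ext c
  exact hθ (congrArg (fun F : WithConv (C →ₗ[k] B) => F c) h)

/-- The coalgebra morphism `c ⊗ d ↦ ε(d) c`. -/
def legFst (k C D : Type*) [Field k] [AddCommMonoid C] [Module k C] [Coalgebra k C]
    [AddCommMonoid D] [Module k D] [Coalgebra k D] : C ⊗[k] D →ₗc[k] C :=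
  (Coalgebra.TensorProduct.rid k k C).toCoalgHom.comp
    (Coalgebra.TensorProduct.map (.id k C) (counitCoalgHom k D))

/-- The coalgebra morphism `c ⊗ d ↦ ε(c) d`. -/
def legSnd (k C D : Type*) [Field k] [AddCommMonoid C] [Module k C] [Coalgebra k C]
    [AddCommMonoid D] [Module k D] [Coalgebra k D] : C ⊗[k] D →ₗc[k] D :=
  (Coalgebra.TensorProduct.lid k D).toCoalgHom.comp
    (Coalgebra.TensorProduct.map (counitCoalgHom k C) (.id k D))

@[simp] theorem legFst_tmul (c : C) (d : D) :
    legFst k C D (c ⊗ₜ d) = counit (R := k) d • c := by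
  simp [legFst]

@[simp] theorem legSnd_tmul (c : C) (d : D) :
    legSnd k C D (c ⊗ₜ d) = counit (R := k) c • d := by
  simp [legSnd]

theorem convMul_tmul_apply (f g : WithConv (C ⊗[k] D →ₗ[k] A)) (c : C) (d : D) :
    (f * g) (c ⊗ₜ d) = ∑ i ∈ (ℛ k c).index, ∑ j ∈ (ℛ k d).index,
      f ((ℛ k c).left i ⊗ₜ (ℛ k d).left j) * g ((ℛ k c).right i ⊗ₜ (ℛ k d).right j) := by
  rw [LinearMap.convMul_apply, TensorProduct.comul_tmul]
  conv_lhs => rw [← (ℛ k c).eq, ← (ℛ k d).eq]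
  simp [TensorProduct.sum_tmul, TensorProduct.tmul_sum]
  exact Finset.sum_comm

theorem convComap_legFst_mul_legSnd_apply (f : WithConv (C →ₗ[k] A)) (g : WithConv (D →ₗ[k] A))
    (c : C) (d : D) :
    (convComap A (legFst k C D) f * convComap A (legSnd k C D) g) (c ⊗ₜ d) = f c * g d := by
  rw [convMul_tmul_apply]
  simp only [convComap_apply, legFst_tmul, legSnd_tmul, map_smul]
  rw [← sum_counit_right_smul f.ofConv c, ← sum_counit_left_smul g.ofConv d, Finset.sum_mul_sum]
  refine Finset.sum_congr rfl fun i _ => Finset.sum_congr rfl fun j _ => ?_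
  rw [smul_mul_smul_comm, smul_mul_smul_comm, mul_comm]

theorem convComap_legSnd_mul_legFst_apply (f : WithConv (C →ₗ[k] A)) (g : WithConv (D →ₗ[k] A))
    (c : C) (d : D) :
    (convComap A (legSnd k C D) g * convComap A (legFst k C D) f) (c ⊗ₜ d) = g d * f c := by
  rw [convMul_tmul_apply]
  simp only [convComap_apply, legFst_tmul, legSnd_tmul, map_smul]
  rw [Finset.sum_comm]
  rw [← sum_counit_right_smul g.ofConv d, ← sum_counit_left_smul f.ofConv c, Finset.sum_mul_sum]
  refine Finset.sum_congr rfl fun i _ => Finset.sum_congr rfl fun j _ => ?_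
  rw [smul_mul_smul_comm, smul_mul_smul_comm, mul_comm]

/-- Maps on the two legs of `C ⊗ D` commute for the convolution product if their values do. -/
theorem convComap_legs_commute (f : WithConv (C →ₗ[k] A)) (g : WithConv (D →ₗ[k] A))
    (h : ∀ c d, Commute (f c) (g d)) :
    Commute (convComap A (legFst k C D) f) (convComap A (legSnd k C D) g) := by
  apply WithConv.ext
  apply TensorProduct.ext'
  intro c d
  exact (convComap_legFst_mul_legSnd_apply f g c d).trans
    ((h c d).trans (convComap_legSnd_mul_legFst_apply f g c d).symm)

/-- `c ⊗ d ↦ f(c₁) g(d) f'(c₂)` as a convolution product. -/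
theorem convComap_legFst_legSnd_legFst_apply (f f' : WithConv (C →ₗ[k] A))
    (g : WithConv (D →ₗ[k] A)) (c : C) (d : D) :
    (convComap A (legFst k C D) f * convComap A (legSnd k C D) g *
      convComap A (legFst k C D) f') (c ⊗ₜ d) = (f * convConst k C (g d) * f') c := by
  rw [convMul_tmul_apply]
  rw [(ℛ k c).convMul_apply]
  simp only [convComap_legFst_mul_legSnd_apply, mul_convConst_apply]
  refine Finset.sum_congr rfl fun i _ => ?_
  rw [← sum_counit_right_smul g.ofConv d, Finset.mul_sum, Finset.sum_mul]
  refine Finset.sum_congr rfl fun j _ => ?_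
  simp only [convComap_apply, legFst_tmul, map_smul, mul_smul_comm, smul_mul_assoc]

end Convolution

/-! ### The antipode and the comultiplication -/

section Antipode

open WithConv Coalgebra HopfAlgebra

variable {k : Type*} [Field k] {H : Type*} [Ring H] [HopfAlgebra k H]

variable (k H) in
/-- The element `h ↦ 1 ⊗ h` of the convolution algebra `Hom(H, P ⊗ H)`. -/
def convRight (P : Type*) [Ring P] [Algebra k P] : WithConv (H →ₗ[k] P ⊗[k] H) :=
  toConv (Algebra.TensorProduct.includeRight : H →ₐ[k] P ⊗[k] H).toLinearMap

variable (k H) in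
/-- The element `h ↦ 1 ⊗ S h` of the convolution algebra `Hom(H, P ⊗ H)`. -/
def convRightAntipode (P : Type*) [Ring P] [Algebra k P] : WithConv (H →ₗ[k] P ⊗[k] H) :=
  convMap H (Algebra.TensorProduct.includeRight : H →ₐ[k] P ⊗[k] H) (toConv (antipode k))

@[simp] theorem convRight_apply (P : Type*) [Ring P] [Algebra k P] (h : H) :
    (convRight k H P) h = 1 ⊗ₜ h := rfl

@[simp] theorem convRightAntipode_apply (P : Type*) [Ring P] [Algebra k P] (h : H) :
    (convRightAntipode k H P) h = 1 ⊗ₜ antipode k h := rfl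

theorem convRight_mul_convRightAntipode (P : Type*) [Ring P] [Algebra k P] :
    convRight k H P * convRightAntipode k H P = 1 := by
  have h := congrArg (convMap H (Algebra.TensorProduct.includeRight : H →ₐ[k] P ⊗[k] H))
    (LinearMap.id_mul_antipode (R := k) (C := H))
  rwa [map_mul, map_one] at h

theorem convRightAntipode_mul_convRight (P : Type*) [Ring P] [Algebra k P] :
    convRightAntipode k H P * convRight k H P = 1 := by
  have h := congrArg (convMap H (Algebra.TensorProduct.includeRight : H →ₐ[k] P ⊗[k] H))
    (LinearMap.antipode_mul_id (R := k) (C := H))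
  rwa [map_mul, map_one] at h

/-- The antipode is an anticoalgebra morphism: both sides are convolution inverse to `Δ`. -/
theorem comul_antipode (h : H) :
    comul (R := k) (antipode k h) =
      TensorProduct.map (antipode k) (antipode k)
        (TensorProduct.comm k H H (comul (R := k) h)) := by
  have key : toConv (TensorProduct.map (antipode k) (antipode k) ∘ₗ
      (TensorProduct.comm k H H).toLinearMap ∘ₗ comul) * toConv (comul (R := k) (A := H)) = 1 := by
    have hΔ : toConv (comul (R := k) (A := H)) =
        convMap H (Algebra.TensorProduct.includeLeft : H →ₐ[k] H ⊗[k] H) (toConv .id) *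
          convRight k H H := by
      ext h
      rw [(ℛ k h).convMul_apply]
      simp [← (ℛ k h).eq]
    have hG : toConv (TensorProduct.map (antipode k) (antipode k) ∘ₗ
        (TensorProduct.comm k H H).toLinearMap ∘ₗ comul) = convRightAntipode k H H *
          convMap H (Algebra.TensorProduct.includeLeft : H →ₐ[k] H ⊗[k] H)
            (toConv (antipode k)) := by
      ext h
      rw [(ℛ k h).convMul_apply]
      simp [← (ℛ k h).eq]
    rw [hΔ, hG, mul_assoc, ← mul_assoc (convMap H _ _), ← map_mul, LinearMap.antipode_mul_id,
      map_one, one_mul, convRightAntipode_mul_convRight]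
  have h' := left_inv_eq_right_inv key LinearMap.comul_right_inv
  exact congrArg (fun f : WithConv (H →ₗ[k] H ⊗[k] H) => f h) h'.symm

theorem convOne_eval_one {P : Type*} [Ring P] [Algebra k P] (f g : WithConv (H →ₗ[k] P)) :
    (f * g) 1 = f 1 * g 1 := by
  rw [LinearMap.convMul_apply, Bialgebra.comul_one, Algebra.TensorProduct.one_def]
  simp

end Antipode

/-! ### Colinear maps, cleaving maps and total integrals -/

namespace Coaction

open WithConv Coalgebra HopfAlgebra

variable {k : Type*} [Field k] {H : Type*} [Ring H] [HopfAlgebra k H]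
variable {P : Type*} [Ring P] [Algebra k P] (c : Coaction k H P)
variable {A B : Type*} [Ring A] [Algebra k A] [Ring B] [Algebra k B]

/-- The map `p ↦ φ(p₀) f(p₁)`: the right action of the convolution algebra `Hom(H, A)` on
`Hom(P, A)`. -/
def convAct (φ : P →ₗ[k] A) (f : WithConv (H →ₗ[k] A)) : P →ₗ[k] A :=
  LinearMap.mul' k A ∘ₗ TensorProduct.map φ f.ofConv ∘ₗ c.δ.toLinearMap

theorem convAct_one (φ : P →ₗ[k] A) : c.convAct φ 1 = φ := by
  ext p
  have h : LinearMap.mul' k A ∘ₗ TensorProduct.map φ (1 : WithConv (H →ₗ[k] A)).ofConv =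
      φ ∘ₗ (TensorProduct.rid k P).toLinearMap ∘ₗ
        (Coalgebra.counit (R := k) (A := H)).lTensor P := by
    ext p h
    simp [Algebra.algebraMap_eq_smul_one]
  have h' := LinearMap.congr_fun h (c.δ p)
  simp only [LinearMap.comp_apply, LinearEquiv.coe_coe, c.counit p] at h'
  exact h'

theorem convAct_mul (φ : P →ₗ[k] A) (f g : WithConv (H →ₗ[k] A)) :
    c.convAct φ (f * g) = c.convAct (c.convAct φ f) g := by
  ext p
  have h : LinearMap.mul' k A ∘ₗ TensorProduct.map φ (f * g).ofConv =
      LinearMap.mul' k A ∘ₗ TensorProduct.map φ (LinearMap.mul' k A) ∘ₗ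
        TensorProduct.map .id (TensorProduct.map f.ofConv g.ofConv) ∘ₗ
        (comul (R := k) (A := H)).lTensor P := by
    ext p h
    simp
  have h1 := LinearMap.congr_fun h (c.δ p)
  have h2 : LinearMap.mul' k A ∘ₗ TensorProduct.map (c.convAct φ f) g.ofConv =
      LinearMap.mul' k A ∘ₗ TensorProduct.map φ (LinearMap.mul' k A) ∘ₗ
        TensorProduct.map .id (TensorProduct.map f.ofConv g.ofConv) ∘ₗ
        (TensorProduct.assoc k P H H).toLinearMap ∘ₗ c.δ.toLinearMap.rTensor H := by
    have h3 : LinearMap.mul' k A ∘ₗ TensorProduct.map (LinearMap.mul' k A ∘ₗ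
          TensorProduct.map φ f.ofConv) g.ofConv =
        LinearMap.mul' k A ∘ₗ TensorProduct.map φ (LinearMap.mul' k A) ∘ₗ
          TensorProduct.map .id (TensorProduct.map f.ofConv g.ofConv) ∘ₗ
          (TensorProduct.assoc k P H H).toLinearMap := by
      ext p h h'
      simp [mul_assoc]
    ext p h
    exact LinearMap.congr_fun h3 (c.δ p ⊗ₜ h)
  have h4 := LinearMap.congr_fun h2 (c.δ p)
  simp only [LinearMap.comp_apply, LinearEquiv.coe_coe] at h1 h4
  rw [c.coassoc p] at h4
  exact h1.trans h4.symm

theorem convAct_sum {ι : Type*} (s : Finset ι) (φ : P →ₗ[k] A)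
    (f : ι → WithConv (H →ₗ[k] A)) :
    c.convAct φ (∑ i ∈ s, f i) = ∑ i ∈ s, c.convAct φ (f i) := by
  classical
  induction s using Finset.induction_on with
  | empty => ext p; simp [convAct]
  | insert i s hi ih =>
    rw [Finset.sum_insert hi, Finset.sum_insert hi, ← ih]
    ext p
    simp [convAct, TensorProduct.map_add_right]

theorem comp_convAct (θ : A →ₐ[k] B) (φ : P →ₗ[k] A) (f : WithConv (H →ₗ[k] A)) :
    θ.toLinearMap ∘ₗ c.convAct φ f = c.convAct (θ.toLinearMap ∘ₗ φ) (convMap H θ f) := by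
  have h : θ.toLinearMap ∘ₗ LinearMap.mul' k A ∘ₗ TensorProduct.map φ f.ofConv =
      LinearMap.mul' k B ∘ₗ TensorProduct.map (θ.toLinearMap ∘ₗ φ) (convMap H θ f).ofConv := by
    ext p h
    simp
  ext p
  exact LinearMap.congr_fun h (c.δ p)

theorem convAct_mulRight (φ : P →ₗ[k] A) (f : WithConv (H →ₗ[k] A)) (a : A) (p : P) :
    c.convAct φ (toConv (LinearMap.mulRight k a ∘ₗ f.ofConv)) p = c.convAct φ f p * a := by
  have h : LinearMap.mul' k A ∘ₗ TensorProduct.map φ (LinearMap.mulRight k a ∘ₗ f.ofConv) =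
      LinearMap.mulRight k a ∘ₗ LinearMap.mul' k A ∘ₗ TensorProduct.map φ f.ofConv := by
    ext p h
    simp [mul_assoc]
  exact LinearMap.congr_fun h (c.δ p)

/-- The inclusion `p ↦ p ⊗ 1` as an algebra morphism `P → P ⊗ H`. -/
abbrev incl (k H P : Type*) [Field k] [Ring H] [HopfAlgebra k H] [Ring P] [Algebra k P] :
    P →ₐ[k] P ⊗[k] H :=
  Algebra.TensorProduct.includeLeft

theorem convAct_incl_convRight :
    c.convAct (incl k H P).toLinearMap (convRight k H P) = c.δ.toLinearMap := by
  have h : LinearMap.mul' k (P ⊗[k] H) ∘ₗ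
      TensorProduct.map (incl k H P).toLinearMap (convRight k H P).ofConv = .id := by
    ext p h
    simp
  ext p
  exact LinearMap.congr_fun h (c.δ p)

theorem convAct_δ_convRightAntipode :
    c.convAct c.δ.toLinearMap (convRightAntipode k H P) = (incl k H P).toLinearMap := by
  rw [← convAct_incl_convRight, ← convAct_mul, convRight_mul_convRightAntipode, convAct_one]

/-- Right `H`-colinear maps `H → P`. -/
def IsColinear (γ : H →ₗ[k] P) : Prop :=
  ∀ h : H, c.δ (γ h) = γ.rTensor H (comul (R := k) h)

theorem isColinear_iff (γ : H →ₗ[k] P) : c.IsColinear γ ↔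
    convMap H c.δ (toConv γ) = convMap H (incl k H P) (toConv γ) * convRight k H P := by
  have key : (convMap H (incl k H P) (toConv γ) * convRight k H P).ofConv =
      γ.rTensor H ∘ₗ comul := by
    ext h
    rw [(ℛ k h).convMul_apply]
    simp [← (ℛ k h).eq]
  constructor
  · intro h
    apply WithConv.ext
    rw [key]
    ext x
    exact h x
  · intro h x
    have := congrArg WithConv.ofConv h
    rw [key] at this
    exact LinearMap.congr_fun this x

theorem canLift_mul (p : P) (z : P ⊗[k] P) :
    c.canLift ((p ⊗ₜ 1) * z) = (p ⊗ₜ 1) * c.canLift z := by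
  induction z with
  | zero => simp
  | add x y hx hy => rw [mul_add, map_add, hx, hy, map_add, mul_add]
  | tmul a b => simp [canLift_tmul, ← mul_assoc]

/-- By left `P`-linearity the lifted canonical map is surjective once it attains all `1 ⊗ h`. -/
theorem canLift_surjective (h : ∀ h : H, ∃ z, c.canLift z = 1 ⊗ₜ h) :
    Function.Surjective c.canLift := by
  intro y
  induction y with
  | zero => exact ⟨0, map_zero _⟩
  | add x y hx hy =>
    obtain ⟨a, rfl⟩ := hx
    obtain ⟨b, rfl⟩ := hy
    exact ⟨a + b, map_add _ _ _⟩
  | tmul p x =>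
    obtain ⟨z, hz⟩ := h x
    exact ⟨(p ⊗ₜ 1) * z, by rw [canLift_mul, hz]; simp⟩

/-- A cleaving map `γ` gives the preimages `γ⁻¹(h₁) ⊗ γ(h₂)` of `1 ⊗ h`. -/
theorem canLift_surjective_of_isColinear {γ : H →ₗ[k] P} (hγ : c.IsColinear γ)
    (hu : IsUnit (toConv γ)) : Function.Surjective c.canLift := by
  obtain ⟨u, hu⟩ := hu
  refine c.canLift_surjective fun h =>
    ⟨TensorProduct.map (↑u⁻¹ : WithConv (H →ₗ[k] P)).ofConv γ (comul (R := k) h), ?_⟩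
  have h1 : convMap H (incl k H P) ↑u⁻¹ * convMap H c.δ (toConv γ) = convRight k H P := by
    rw [(c.isColinear_iff γ).1 hγ, ← hu, ← mul_assoc, ← map_mul, Units.inv_mul, map_one, one_mul]
  have h2 := congrArg (fun f : WithConv (H →ₗ[k] P ⊗[k] H) => f h) h1
  simp only [convRight_apply] at h2
  rw [← h2, (ℛ k h).convMul_apply, ← (ℛ k h).eq]
  simp [canLift_tmul]

/-- A total integral: a right `H`-colinear map `H → P` with value `1` at `1`. -/
structure IsTotalIntegral (j : H →ₗ[k] P) : Prop where
  colinear : c.IsColinear j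
  map_one : j 1 = 1

/-- A cleaving map can be normalized by `γ(1) = 1`. -/
theorem IsCleft.exists_isTotalIntegral {c : Coaction k H P} (hc : c.IsCleft) :
    ∃ γ : H →ₗ[k] P, c.IsTotalIntegral γ ∧ IsUnit (toConv γ) := by
  obtain ⟨γ, hγ, u, hu⟩ := hc
  set a : P := (↑u⁻¹ : WithConv (H →ₗ[k] P)) 1
  have h1 : a * γ 1 = 1 := by
    have := convOne_eval_one (↑u⁻¹ : WithConv (H →ₗ[k] P)) ↑u
    rw [Units.inv_mul, hu] at this
    simpa using this.symm
  have h2 : γ 1 * a = 1 := by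
    have := convOne_eval_one (↑u : WithConv (H →ₗ[k] P)) ↑u⁻¹
    rw [Units.mul_inv, hu] at this
    simpa using this.symm
  have hγ1 : c.δ (γ 1) = incl k H P (γ 1) := by
    rw [hγ, Bialgebra.comul_one, Algebra.TensorProduct.one_def]
    simp
  have ha : c.δ a = incl k H P a := by
    refine left_inv_eq_right_inv (a := c.δ (γ 1)) ?_ ?_
    · rw [← map_mul, h1, map_one]
    · rw [hγ1, ← map_mul, h2, map_one]
  have hunit : IsUnit (convConst k H a) :=
    ((Units.mk a (γ 1) h1 h2).isUnit).map (convConst k H)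
  refine ⟨(convConst k H a * toConv γ).ofConv, ⟨?_, ?_⟩, ?_⟩
  · rw [isColinear_iff, toConv_ofConv, map_mul, map_mul, (c.isColinear_iff γ).1 hγ,
      convMap_convConst, convMap_convConst, ha, mul_assoc]
  · rw [convConst_mul_apply]
    exact h1
  · rw [toConv_ofConv, ← hu]
    exact hunit.mul u.isUnit

/-- For a linear map `j : H → P`, the map `P ⊗ H → P`, `p ⊗ g ↦ p₀ j(S(p₁) g)`. -/
def retraction (j : H →ₗ[k] P) : P ⊗[k] H →ₗ[k] P :=
  LinearMap.mul' k P ∘ₗ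
    (j ∘ₗ LinearMap.mul' k H ∘ₗ (antipode k (A := H)).rTensor H).lTensor P ∘ₗ
    (TensorProduct.assoc k P H H).toLinearMap ∘ₗ c.δ.toLinearMap.rTensor H

theorem retraction_tmul (j : H →ₗ[k] P) (p : P) (g : H) : c.retraction j (p ⊗ₜ g) =
    c.convAct .id (toConv (j ∘ₗ LinearMap.mulRight k g ∘ₗ antipode k)) p := by
  have h : (LinearMap.mul' k P ∘ₗ
      (j ∘ₗ LinearMap.mul' k H ∘ₗ (antipode k (A := H)).rTensor H).lTensor P ∘ₗ
      (TensorProduct.assoc k P H H).toLinearMap) ∘ₗ (TensorProduct.mk k (P ⊗[k] H) H).flip g =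
      LinearMap.mul' k P ∘ₗ TensorProduct.map .id (j ∘ₗ LinearMap.mulRight k g ∘ₗ antipode k) := by
    ext p h
    simp
  exact LinearMap.congr_fun h (c.δ p)

theorem retraction_δ {j : H →ₗ[k] P} (hj : j 1 = 1) (p : P) : c.retraction j (c.δ p) = p := by
  have h : LinearMap.mul' k P ∘ₗ
      (j ∘ₗ LinearMap.mul' k H ∘ₗ (antipode k (A := H)).rTensor H).lTensor P ∘ₗ
      (comul (R := k) (A := H)).lTensor P =
      (TensorProduct.rid k P).toLinearMap ∘ₗ (Coalgebra.counit (R := k) (A := H)).lTensor P := by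
    ext p h
    simp [Algebra.algebraMap_eq_smul_one, hj]
  have h1 := LinearMap.congr_fun h (c.δ p)
  simp only [LinearMap.comp_apply, LinearEquiv.coe_coe, c.counit p, ← c.coassoc p] at h1
  exact h1

/-- For colinear `j`, the map `p ⊗ g ↦ p₀ j(S(p₁) g)` is colinear on `P ⊗ H` with the coaction
`id ⊗ Δ`. -/
theorem δ_retraction {j : H →ₗ[k] P} (hj : c.IsColinear j) (z : P ⊗[k] H) :
    c.δ (c.retraction j z) = (c.retraction j).rTensor H (freeCoaction k H P z) := by
  induction z with
  | zero => simp
  | add x y hx hy => simp only [map_add, hx, hy]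
  | tmul p g =>
    set r := ℛ k g
    have hδ : convMap H c.δ (toConv (j ∘ₗ LinearMap.mulRight k g ∘ₗ antipode k)) =
        ∑ i ∈ r.index, convRightAntipode k H P * toConv (LinearMap.mulRight k (1 ⊗ₜ r.right i) ∘ₗ
          (convMap H (incl k H P)
            (toConv (j ∘ₗ LinearMap.mulRight k (r.left i) ∘ₗ antipode k))).ofConv) := by
      ext h
      simp only [convMap_apply, LinearMap.comp_apply, LinearMap.mulRight_apply]
      rw [hj, Bialgebra.comul_mul, comul_antipode, WithConv.ofConv_sum, LinearMap.sum_apply]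
      simp only [(ℛ k h).convMul_apply]
      rw [← r.eq, ← (ℛ k h).eq]
      simp [Finset.mul_sum, Finset.sum_mul]
    have h1 := LinearMap.congr_fun (c.comp_convAct c.δ .id
      (toConv (j ∘ₗ LinearMap.mulRight k g ∘ₗ antipode k))) p
    rw [hδ, convAct_sum] at h1
    simp only [convAct_mul, LinearMap.comp_id, convAct_δ_convRightAntipode] at h1
    rw [retraction_tmul]
    refine h1.trans ?_
    rw [LinearMap.sum_apply]
    simp only [convAct_mulRight]
    simp only [freeCoaction, LinearMap.comp_apply, LinearEquiv.coe_coe, LinearMap.lTensor_tmul]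
    rw [← r.eq]
    simp only [TensorProduct.tmul_sum, map_sum, TensorProduct.assoc_symm_tmul,
      LinearMap.rTensor_tmul, retraction_tmul]
    refine Finset.sum_congr rfl fun i _ => ?_
    have h2 := LinearMap.congr_fun (c.comp_convAct (incl k H P) .id
      (toConv (j ∘ₗ LinearMap.mulRight k (r.left i) ∘ₗ antipode k))) p
    rw [LinearMap.comp_id] at h2
    rw [← h2]
    simp

end Coaction

/-! ### Total integrals and the Galois condition -/

namespace Coaction

open WithConv Coalgebra HopfAlgebra

variable {k : Type*} [Field k] {H : Type*} [Ring H] [HopfAlgebra k H]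
variable {P : Type*} [Ring P] [Algebra k P] (c : Coaction k H P)

/-- The map `p ⊗ h ↦ y₀ j(S(y₁) T(h)) p`. -/
def sandwich (j : H →ₗ[k] P) (T : H →ₗ[k] H) (y : P) : P ⊗[k] H →ₗ[k] P :=
  TensorProduct.lift ((LinearMap.mul k P).compl₂ .id ∘ₗ
    (c.retraction j ∘ₗ TensorProduct.mk k P H y ∘ₗ T)).flip

@[simp] theorem sandwich_tmul (j : H →ₗ[k] P) (T : H →ₗ[k] H) (y p : P) (h : H) :
    c.sandwich j T y (p ⊗ₜ h) = c.retraction j (y ⊗ₜ T h) * p := rfl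

theorem sandwich_mul_incl (j : H →ₗ[k] P) (T : H →ₗ[k] H) (y : P) (q : P ⊗[k] H) (p : P) :
    c.sandwich j T y (q * p ⊗ₜ 1) = c.sandwich j T y q * p := by
  induction q with
  | zero => simp
  | add x y hx hy => rw [add_mul, map_add, hx, hy, map_add, add_mul]
  | tmul a b => simp [mul_assoc]

/-- If `T` is an inverse of the antipode, then `T` is an anticoalgebra morphism. -/
theorem comul_of_antipode_inverse {T : H →ₗ[k] H} (hST : ∀ h, antipode k (T h) = h)
    (hTS : ∀ h, T (antipode k h) = h) (h : H) :
    comul (R := k) (T h) =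
      TensorProduct.map T T (TensorProduct.comm k H H (comul (R := k) h)) := by
  have hid : TensorProduct.map T T ∘ₗ TensorProduct.map (antipode k) (antipode k) =
      (.id : H ⊗[k] H →ₗ[k] H ⊗[k] H) := by
    ext a b
    simp [hTS]
  have hcomm (z : H ⊗[k] H) : TensorProduct.map T T (TensorProduct.comm k H H z) =
      TensorProduct.comm k H H (TensorProduct.map T T z) := by
    induction z with
    | zero => simp
    | add x y hx hy => simp only [map_add, hx, hy]
    | tmul a b => simp
  conv_rhs => rw [← hST h, comul_antipode, hcomm]
  rw [← LinearMap.comp_apply (TensorProduct.map T T), hid]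
  simp only [LinearMap.id_apply]
  exact ((TensorProduct.comm k H H).symm_apply_apply _).symm

/-- If `T` is an inverse of the antipode, then `T(h₂) h₁ = ε(h)`. -/
theorem sum_antipode_inverse_mul {T : H →ₗ[k] H} (hST : ∀ h, antipode k (T h) = h)
    (hTS : ∀ h, T (antipode k h) = h) (h : H) :
    ∑ i ∈ (ℛ k h).index, T ((ℛ k h).right i) * (ℛ k h).left i =
      algebraMap k H (Coalgebra.counit (R := k) h) := by
  have hinj : Function.Injective (antipode k : H →ₗ[k] H) :=
    Function.LeftInverse.injective hTS
  apply hinj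
  rw [map_sum]
  simp only [antipode_mul_antidistrib, hST]
  rw [sum_antipode_mul_eq_algebraMap_counit, Algebra.algebraMap_eq_smul_one, map_smul,
    antipode_one]

/-- The element `y₀ j(S(y₁) T(x₁)) x₀` is coinvariant. -/
theorem sandwich_δ_mem_coinvariants {j : H →ₗ[k] P} (hj : c.IsColinear j) {T : H →ₗ[k] H}
    (hST : ∀ h, antipode k (T h) = h) (hTS : ∀ h, T (antipode k h) = h) (y x : P) :
    c.sandwich j T y (c.δ x) ∈ c.coinvariants := by
  let opP := (MulOpposite.opLinearEquiv k : P ≃ₗ[k] Pᵐᵒᵖ).toLinearMap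
  let opPH := (MulOpposite.opLinearEquiv k : P ⊗[k] H ≃ₗ[k] (P ⊗[k] H)ᵐᵒᵖ).toLinearMap
  let f : H →ₗ[k] P := c.retraction j ∘ₗ TensorProduct.mk k P H y ∘ₗ T
  let i := incl k H P
  let rr : WithConv (H →ₗ[k] (P ⊗[k] H)ᵐᵒᵖ) := toConv (opPH ∘ₗ (convRight k H P).ofConv)
  let rT : WithConv (H →ₗ[k] (P ⊗[k] H)ᵐᵒᵖ) := toConv (opPH ∘ₗ (convRight k H P).ofConv ∘ₗ T)
  -- the order of the factors `T(x₁)` and `x₀` calls for the opposite algebras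
  have hN : c.convAct opP (toConv (opP ∘ₗ f)) = opP ∘ₗ c.sandwich j T y ∘ₗ c.δ.toLinearMap := by
    have h : LinearMap.mul' k Pᵐᵒᵖ ∘ₗ TensorProduct.map opP (opP ∘ₗ f) =
        opP ∘ₗ c.sandwich j T y := by
      ext p h
      simp [opP, f]
    ext x
    exact LinearMap.congr_fun h (c.δ x)
  have h1 : c.convAct (opPH ∘ₗ i.toLinearMap) rr = opPH ∘ₗ c.δ.toLinearMap := by
    have h : LinearMap.mul' k (P ⊗[k] H)ᵐᵒᵖ ∘ₗ
        TensorProduct.map (opPH ∘ₗ i.toLinearMap) rr.ofConv = opPH := by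
      ext p h
      simp [opPH, i, rr, ← MulOpposite.op_mul]
    ext p
    exact LinearMap.congr_fun h (c.δ p)
  have h2 : convMap H (AlgHom.op c.δ) (toConv (opP ∘ₗ f)) =
      rT * convMap H (AlgHom.op i) (toConv (opP ∘ₗ f)) := by
    ext h
    rw [(ℛ k h).convMul_apply]
    simp only [convMap_apply, LinearMap.comp_apply, opP, rT, opPH, f, i, LinearEquiv.coe_coe,
      MulOpposite.coe_opLinearEquiv, AlgHom.op_apply_apply, MulOpposite.unop_op,
      TensorProduct.mk_apply]
    rw [δ_retraction c hj]
    simp only [freeCoaction, LinearMap.comp_apply, LinearEquiv.coe_coe, LinearMap.lTensor_tmul]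
    rw [comul_of_antipode_inverse hST hTS, ← (ℛ k h).eq]
    simp [TensorProduct.tmul_sum, ← MulOpposite.op_mul]
  have h3 : rr * rT = 1 := by
    ext h
    rw [(ℛ k h).convMul_apply]
    simp only [rr, rT, opPH, LinearMap.comp_apply, LinearEquiv.coe_coe,
      MulOpposite.coe_opLinearEquiv, convRight_apply, ← MulOpposite.op_mul,
      Algebra.TensorProduct.tmul_mul_tmul, mul_one]
    rw [← Finset.op_sum, ← TensorProduct.tmul_sum, sum_antipode_inverse_mul hST hTS]
    simp only [Algebra.algebraMap_eq_smul_one, TensorProduct.tmul_smul, MulOpposite.op_smul,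
      LinearMap.convOne_apply]
    rfl
  have h4 := c.comp_convAct (AlgHom.op c.δ) opP (toConv (opP ∘ₗ f))
  have h5 := c.comp_convAct (AlgHom.op i) opP (toConv (opP ∘ₗ f))
  have h6 : (AlgHom.op c.δ).toLinearMap ∘ₗ opP = opPH ∘ₗ c.δ.toLinearMap := rfl
  have h7 : (AlgHom.op i).toLinearMap ∘ₗ opP = opPH ∘ₗ i.toLinearMap := rfl
  rw [h6, h2, ← h1, ← convAct_mul, ← mul_assoc, h3, one_mul, ← h7, ← h5, hN] at h4
  exact MulOpposite.op_injective (LinearMap.congr_fun h4 x)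

/-- The map `h ⊗ (x ⊗ x') ↦ j(S(h) T(x₁)) x₀ ⊗ x'`. -/
def average (j : H →ₗ[k] P) (T : H →ₗ[k] H) : H ⊗[k] (P ⊗[k] P) →ₗ[k] P ⊗[k] P :=
  (LinearMap.mul' k P ∘ₗ (TensorProduct.comm k P P).toLinearMap ∘ₗ
    (j ∘ₗ LinearMap.mul' k H ∘ₗ TensorProduct.map (antipode k) T).lTensor P ∘ₗ
    (TensorProduct.leftComm k H P H).toLinearMap ∘ₗ c.δ.toLinearMap.lTensor H).rTensor P ∘ₗ
  (TensorProduct.assoc k H P P).symm.toLinearMap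

/-- The multiplication `p ⊗ z ↦ p z` of `P` on the first factor of `P ⊗ P`. -/
def mulFirst (k P : Type*) [Field k] [Ring P] [Algebra k P] :
    P ⊗[k] (P ⊗[k] P) →ₗ[k] P ⊗[k] P :=
  (LinearMap.mul' k P).rTensor P ∘ₗ (TensorProduct.assoc k P P P).symm.toLinearMap

/-- The map `y ⊗ (x ⊗ x') ↦ y₀ j(S(y₁) T(x₁)) x₀ ⊗ x'`. -/
def sandwichMap (j : H →ₗ[k] P) (T : H →ₗ[k] H) : P ⊗[k] (P ⊗[k] P) →ₗ[k] P ⊗[k] P :=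
  mulFirst k P ∘ₗ (c.average j T).lTensor P ∘ₗ
    (TensorProduct.assoc k P H (P ⊗[k] P)).toLinearMap ∘ₗ c.δ.toLinearMap.rTensor (P ⊗[k] P)

theorem mulFirst_tmul (p : P) (z : P ⊗[k] P) : mulFirst k P (p ⊗ₜ z) = (p ⊗ₜ 1) * z := by
  induction z with
  | zero => simp
  | add x y hx hy => rw [TensorProduct.tmul_add, map_add, hx, hy, mul_add]
  | tmul a b => simp [mulFirst]

theorem sandwichMap_tmul (j : H →ₗ[k] P) (T : H →ₗ[k] H) (y x x' : P) :
    c.sandwichMap j T (y ⊗ₜ (x ⊗ₜ x')) = c.sandwich j T y (c.δ x) ⊗ₜ x' := by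
  obtain ⟨s, hs⟩ := TensorProduct.exists_finset (c.δ y)
  obtain ⟨t, ht⟩ := TensorProduct.exists_finset (c.δ x)
  have h1 : c.sandwichMap j T (y ⊗ₜ (x ⊗ₜ x')) = ∑ a ∈ s, ∑ b ∈ t,
      (a.1 * (j (antipode k a.2 * T b.2) * b.1)) ⊗ₜ x' := by
    simp [sandwichMap, average, mulFirst, hs, ht, TensorProduct.sum_tmul, TensorProduct.tmul_sum]
  have h2 : c.sandwich j T y (c.δ x) = ∑ b ∈ t, ∑ a ∈ s,
      (a.1 * (j (antipode k a.2 * T b.2) * b.1)) := by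
    simp [retraction, hs, ht, TensorProduct.sum_tmul, Finset.sum_mul, mul_assoc]
  rw [h1, h2, Finset.sum_comm]
  simp [TensorProduct.sum_tmul]

/-- The map `p ⊗ h ↦ p₀ ⊗ p₁ S(h)`. -/
def untwist : P ⊗[k] H →ₗ[k] P ⊗[k] H :=
  LinearMap.mul' k (P ⊗[k] H) ∘ₗ
    TensorProduct.map c.δ.toLinearMap (convRightAntipode k H P).ofConv

theorem untwist_canLift (x x' : P) : c.untwist (c.canLift (x ⊗ₜ x')) = c.δ x * x' ⊗ₜ 1 := by
  have h (q : P ⊗[k] H) : c.untwist ((x ⊗ₜ (1 : H)) * q) = c.δ x * c.untwist q := by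
    induction q with
    | zero => simp
    | add a b ha hb => rw [mul_add, map_add, ha, hb, map_add, mul_add]
    | tmul a b => simp [untwist, mul_assoc]
  rw [canLift_tmul, h]
  congr 1
  exact LinearMap.congr_fun c.convAct_δ_convRightAntipode x'

/-- Multiplying out `y₀ j(S(y₁) T(x₁)) x₀ ⊗ x'` gives a function of the image of `x ⊗ x'` under
the lifted canonical map. -/
theorem mul'_sandwichMap (j : H →ₗ[k] P) (T : H →ₗ[k] H) (y : P) (z : P ⊗[k] P) :
    LinearMap.mul' k P (c.sandwichMap j T (y ⊗ₜ z)) =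
      c.sandwich j T y (c.untwist (c.canLift z)) := by
  induction z with
  | zero => simp
  | add a b ha hb => rw [TensorProduct.tmul_add, map_add, map_add, ha, hb]; simp only [map_add]
  | tmul x x' =>
    rw [sandwichMap_tmul, untwist_canLift, sandwich_mul_incl, LinearMap.mul'_apply]

theorem mul_sub_mem_balancing {b : P} (hb : b ∈ c.coinvariants) (a p : P) :
    (a ⊗ₜ[k] (1 : P)) * b ⊗ₜ p - a ⊗ₜ (b * p) ∈ c.balancing := by
  rw [Algebra.TensorProduct.tmul_mul_tmul, one_mul]
  exact Submodule.subset_span ⟨a, p, b, hb, rfl⟩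

theorem sandwichMap_sub_mem_balancing {j : H →ₗ[k] P} (hj : c.IsColinear j) {T : H →ₗ[k] H}
    (hST : ∀ h, antipode k (T h) = h) (hTS : ∀ h, T (antipode k h) = h) (a : P)
    (w : P ⊗[k] (P ⊗[k] P)) :
    (a ⊗ₜ[k] (1 : P)) * c.sandwichMap j T w - a ⊗ₜ LinearMap.mul' k P (c.sandwichMap j T w) ∈
      c.balancing := by
  induction w with
  | zero => simp
  | add u v hu hv =>
    rw [map_add, mul_add, map_add, TensorProduct.tmul_add, add_sub_add_comm]
    exact add_mem hu hv
  | tmul y z =>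
    induction z with
    | zero => simp
    | add u v hu hv =>
      rw [TensorProduct.tmul_add, map_add, mul_add, map_add, TensorProduct.tmul_add,
        add_sub_add_comm]
      exact add_mem hu hv
    | tmul x x' =>
      rw [sandwichMap_tmul, LinearMap.mul'_apply]
      exact c.mul_sub_mem_balancing (c.sandwich_δ_mem_coinvariants hj hST hTS y x) a x'

/-- If `P` has a total integral `j`, the lifted canonical map is surjective and the antipode is
bijective with inverse `T`, then `P` is Hopf–Galois. For a linear map `ℓ` with
`canLift (ℓ h) = 1 ⊗ h`, written `ℓ h = x ⊗ x'`, the inverse of the canonical map is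
`p ⊗ h ↦ p j(S(h₁) T(x₁)) x₀ ⊗ x'` with `x ⊗ x' = ℓ(h₂)`. -/
theorem IsTotalIntegral.isHopfGalois {c : Coaction k H P}
    (hS : Function.Bijective (antipode k : H →ₗ[k] H)) {j : H →ₗ[k] P}
    (hj : c.IsTotalIntegral j) (hc : Function.Surjective c.canLift) : c.IsHopfGalois := by
  have hsurj : Function.Surjective c.can := fun y => by
    obtain ⟨z, rfl⟩ := hc y
    exact ⟨Submodule.Quotient.mk z, rfl⟩
  refine ⟨?_, hsurj⟩
  let e := LinearEquiv.ofBijective (antipode k : H →ₗ[k] H) hS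
  let T : H →ₗ[k] H := e.symm.toLinearMap
  have hST : ∀ h, antipode k (T h) = h := fun h => e.apply_symm_apply h
  have hTS : ∀ h, T (antipode k h) = h := fun h => e.symm_apply_apply h
  obtain ⟨s, hs⟩ := c.canLift.exists_rightInverse_of_surjective (LinearMap.range_eq_top.2 hc)
  let l : H →ₗ[k] P ⊗[k] P := s ∘ₗ TensorProduct.mk k P H 1
  have hl (h : H) : c.canLift (l h) = 1 ⊗ₜ h := LinearMap.congr_fun hs (1 ⊗ₜ h)
  let L : P ⊗[k] H →ₗ[k] P ⊗[k] P :=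
    mulFirst k P ∘ₗ (c.average j T ∘ₗ l.lTensor H ∘ₗ comul).lTensor P
  have hLmul (p : P) (q : P ⊗[k] H) : L (p ⊗ₜ 1 * q) = p ⊗ₜ 1 * L q := by
    induction q with
    | zero => simp
    | add a b ha hb => rw [mul_add, map_add, ha, hb, map_add, mul_add]
    | tmul a b => simp [L, mulFirst_tmul, ← mul_assoc]
  have hLδ (y : P) : L (c.δ y) = c.sandwichMap j T (l.lTensor P (c.δ y)) := by
    have h1 : (c.average j T).lTensor P ∘ₗ (l.lTensor H).lTensor P ∘ₗ
        (TensorProduct.assoc k P H H).toLinearMap ∘ₗ c.δ.toLinearMap.rTensor H =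
        (c.average j T).lTensor P ∘ₗ (TensorProduct.assoc k P H (P ⊗[k] P)).toLinearMap ∘ₗ
          c.δ.toLinearMap.rTensor (P ⊗[k] P) ∘ₗ l.lTensor P := by
      ext p h
      simp only [TensorProduct.AlgebraTensorModule.curry_apply, TensorProduct.curry_apply,
        LinearMap.coe_restrictScalars, LinearMap.comp_apply, LinearMap.rTensor_tmul,
        LinearMap.lTensor_tmul, LinearEquiv.coe_coe]
      induction c.δ.toLinearMap p with
      | zero => simp
      | add a b ha hb => simp only [TensorProduct.add_tmul, map_add, ha, hb]
      | tmul a b => simp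
    have h2 := LinearMap.congr_fun h1 (c.δ y)
    simp only [LinearMap.comp_apply, LinearEquiv.coe_coe, c.coassoc y] at h2
    simp only [L, sandwichMap, LinearMap.lTensor_comp, LinearMap.comp_apply, LinearEquiv.coe_coe]
    rw [h2]
  have hmul (y : P) : LinearMap.mul' k P (L (c.δ y)) = y := by
    rw [hLδ]
    have h1 : LinearMap.mul' k P ∘ₗ c.sandwichMap j T ∘ₗ l.lTensor P = c.retraction j := by
      ext p h
      simp only [TensorProduct.AlgebraTensorModule.curry_apply, TensorProduct.curry_apply,
        LinearMap.coe_restrictScalars, LinearMap.comp_apply, LinearMap.lTensor_tmul]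
      rw [mul'_sandwichMap, hl]
      simp [untwist, hTS]
    exact (LinearMap.congr_fun h1 (c.δ y)).trans (c.retraction_δ hj.map_one y)
  have hL (z : P ⊗[k] P) : L (c.canLift z) - z ∈ c.balancing := by
    induction z with
    | zero => simp
    | add a b ha hb =>
      rw [map_add, map_add, add_sub_add_comm]
      exact add_mem ha hb
    | tmul x y =>
      have := c.sandwichMap_sub_mem_balancing hj.colinear hST hTS x (l.lTensor P (c.δ y))
      rwa [← hLδ, hmul, ← hLmul, ← canLift_tmul] at this
  rw [injective_iff_map_eq_zero]
  intro q hq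
  obtain ⟨z, rfl⟩ := Submodule.Quotient.mk_surjective _ q
  have hz : c.canLift z = 0 := hq
  have := hL z
  rw [hz, map_zero, zero_sub, neg_mem_iff] at this
  exact (Submodule.Quotient.mk_eq_zero _).2 this

end Coaction

/-! ### The multiplication of a crossed product -/

section CrossedProduct

open WithConv Coalgebra HopfAlgebra

variable {k : Type*} [Field k] {H : Type*} [Ring H] [HopfAlgebra k H]
variable {A : Type*} [Ring A] [Algebra k A]

theorem CrossedSystem.mul_tmul (s : CrossedSystem k H A) (a b : A) (h l : H) :
    s.mul ((a ⊗ₜ h) ⊗ₜ (b ⊗ₜ l)) = ∑ i ∈ (ℛ k h).index,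
      (LinearMap.mulLeft k (a * s.act ((ℛ k h).left i) b)).rTensor H
        (s.twist ((ℛ k h).right i ⊗ₜ l)) := by
  have key (a x : A) (z : A ⊗[k] H) :
      (LinearMap.mul' k A).rTensor H ((TensorProduct.assoc k A A H).symm
        ((a * x) ⊗ₜ z)) = (LinearMap.mulLeft k (a * x)).rTensor H z := by
    induction z with
    | zero => simp
    | add u v hu hv => rw [TensorProduct.tmul_add, map_add, map_add, map_add, hu, hv]
    | tmul u v => simp [mul_assoc]
  simp only [mul, LinearMap.comp_apply, LinearEquiv.coe_coe, TensorProduct.assoc_tmul,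
    LinearMap.lTensor_tmul, TensorProduct.assoc_symm_tmul, LinearMap.rTensor_tmul, swap]
  conv_lhs => rw [← (ℛ k h).eq]
  simp only [TensorProduct.sum_tmul, TensorProduct.tmul_sum, map_sum,
    TensorProduct.rightComm_tmul, LinearMap.rTensor_tmul, TensorProduct.lift.tmul,
    TensorProduct.assoc_tmul, TensorProduct.assoc_symm_tmul, TensorProduct.map_tmul,
    LinearMap.mul'_apply, key]

/-- The coalgebra morphism `h ↦ h ⊗ 1`. -/
def tmulOne (k H : Type*) [Field k] [Ring H] [HopfAlgebra k H] : H →ₗc[k] H ⊗[k] H where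
  toLinearMap := (TensorProduct.mk k H H).flip 1
  counit_comp := by ext h; simp
  map_comp_comul := by
    ext h
    simp only [LinearMap.comp_apply, LinearMap.flip_apply, TensorProduct.mk_apply,
      TensorProduct.comul_tmul, Bialgebra.comul_one]
    rw [← (ℛ k h).eq]
    simp [TensorProduct.sum_tmul, Algebra.TensorProduct.one_def]

/-- The coalgebra morphism `h ↦ 1 ⊗ h`. -/
def oneTmul (k H : Type*) [Field k] [Ring H] [HopfAlgebra k H] : H →ₗc[k] H ⊗[k] H where
  toLinearMap := TensorProduct.mk k H H 1
  counit_comp := by ext h; simp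
  map_comp_comul := by
    ext h
    simp only [LinearMap.comp_apply, TensorProduct.mk_apply,
      TensorProduct.comul_tmul, Bialgebra.comul_one]
    rw [← (ℛ k h).eq]
    simp [TensorProduct.tmul_sum, Algebra.TensorProduct.one_def]

@[simp] theorem tmulOne_apply (h : H) : tmulOne k H h = h ⊗ₜ 1 := rfl

@[simp] theorem oneTmul_apply (h : H) : oneTmul k H h = 1 ⊗ₜ h := rfl

/-- The multiplication `H ⊗ H → H` as a coalgebra morphism. -/
abbrev mulHom (k H : Type*) [Field k] [Ring H] [HopfAlgebra k H] : H ⊗[k] H →ₗc[k] H :=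
  Bialgebra.mulCoalgHom k H

variable {P : Type*} [Ring P] [Algebra k P]

theorem convComap_mulHom_convRight :
    convComap (P ⊗[k] H) (mulHom k H) (convRight k H P) =
      convComap (P ⊗[k] H) (legFst k H H) (convRight k H P) *
        convComap (P ⊗[k] H) (legSnd k H H) (convRight k H P) := by
  apply WithConv.ext
  apply TensorProduct.ext'
  intro h l
  refine Eq.trans ?_ (convComap_legFst_mul_legSnd_apply _ _ h l).symm
  simp

theorem convConst_mul_convRight (p : P) :
    convConst k H (p ⊗ₜ[k] (1 : H)) * convRight k H P =
      convRight k H P * convConst k H (p ⊗ₜ[k] (1 : H)) := by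
  ext h
  rw [convConst_mul_apply, mul_convConst_apply]
  simp

theorem convComap_legFst_convRight_commute (f : WithConv (H →ₗ[k] P)) :
    Commute (convComap (P ⊗[k] H) (legFst k H H) (convRight k H P))
      (convComap (P ⊗[k] H) (legSnd k H H) (convMap H (Coaction.incl k H P) f)) := by
  apply convComap_legs_commute
  intro a b
  simp [Commute, SemiconjBy]

end CrossedProduct

/-! ### Cleft extensions are crossed products -/

namespace Coaction

open WithConv Coalgebra HopfAlgebra

variable {k : Type*} [Field k] {H : Type*} [Ring H] [HopfAlgebra k H]
variable {P : Type*} [Ring P] [Algebra k P] (c : Coaction k H P)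
variable {A : Type*} [Ring A] [Algebra k A] {σ : A →ₐ[k] P}
variable {C : Type*} [AddCommMonoid C] [Module k C] [Coalgebra k C]

theorem mem_coinvariants_iff (p : P) : p ∈ c.coinvariants ↔ c.δ p = incl k H P p := Iff.rfl

/-- A map with values in the coinvariants factors through an embedding of an algebra onto the
coinvariants. -/
theorem exists_convMap_eq (hσ : Function.Injective σ) (hr : σ.range = c.coinvariants)
    (F : WithConv (C →ₗ[k] P)) (hF : convMap C c.δ F = convMap C (incl k H P) F) :
    ∃ f : WithConv (C →ₗ[k] A), convMap C σ f = F := by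
  have hmem (x : C) : F x ∈ LinearMap.range σ.toLinearMap := by
    have h : F x ∈ c.coinvariants :=
      congrArg (fun G : WithConv (C →ₗ[k] P ⊗[k] H) => G x) hF
    rw [← hr] at h
    exact h
  let e := LinearEquiv.ofInjective σ.toLinearMap hσ
  refine ⟨toConv (e.symm.toLinearMap ∘ₗ F.ofConv.codRestrict _ hmem), ?_⟩
  ext x
  exact congrArg Subtype.val (e.apply_symm_apply ⟨F x, hmem x⟩)

theorem convMap_δ_eq_of_inverse {F G : WithConv (C →ₗ[k] P)} (hFG : F * G = 1) (hGF : G * F = 1)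
    (hF : convMap C c.δ F = convMap C (incl k H P) F) :
    convMap C c.δ G = convMap C (incl k H P) G := by
  refine left_inv_eq_right_inv (a := convMap C c.δ F) ?_ ?_
  · rw [← map_mul, hGF, map_one]
  · rw [hF, ← map_mul, hFG, map_one]

variable {γ γ' : WithConv (H →ₗ[k] P)}

theorem convMap_δ_inverse (hγ : c.IsColinear γ.ofConv) (h1 : γ * γ' = 1) (h2 : γ' * γ = 1) :
    convMap H c.δ γ' = convRightAntipode k H P * convMap H (incl k H P) γ' := by
  refine left_inv_eq_right_inv (a := convMap H c.δ γ) ?_ ?_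
  · rw [← map_mul, h2, map_one]
  · rw [← toConv_ofConv γ, (c.isColinear_iff _).1 hγ, toConv_ofConv, mul_assoc,
      ← mul_assoc (convRight k H P), convRight_mul_convRightAntipode, one_mul, ← map_mul, h1,
      map_one]

/-- The values `γ(h₁) b γ⁻¹(h₂)` with `b` coinvariant are coinvariant. -/
theorem convMap_δ_conj (hγ : c.IsColinear γ.ofConv) (h1 : γ * γ' = 1) (h2 : γ' * γ = 1)
    {b : P} (hb : b ∈ c.coinvariants) :
    convMap H c.δ (γ * convConst k H b * γ') =
      convMap H (incl k H P) (γ * convConst k H b * γ') := by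
  have hγ' := (c.isColinear_iff _).1 hγ
  rw [toConv_ofConv] at hγ'
  rw [map_mul, map_mul, hγ', c.convMap_δ_inverse hγ h1 h2, convMap_convConst,
    (c.mem_coinvariants_iff b).1 hb, map_mul, map_mul, convMap_convConst]
  have h3 := convConst_mul_convRight (k := k) (H := H) b
  calc _ = convMap H (incl k H P) γ * (convRight k H P * convConst k H (b ⊗ₜ[k] (1 : H))) *
        convRightAntipode k H P * convMap H (incl k H P) γ' := by
          simp only [mul_assoc]; rfl
    _ = convMap H (incl k H P) γ * convConst k H (b ⊗ₜ[k] (1 : H)) *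
        (convRight k H P * convRightAntipode k H P) * convMap H (incl k H P) γ' := by
          rw [← h3]; simp only [mul_assoc]
    _ = _ := by rw [convRight_mul_convRightAntipode, mul_one]; rfl

/-- The values `γ(h₁) γ(l₁) γ⁻¹(h₂ l₂)` are coinvariant. -/
theorem convMap_δ_cocycle (hγ : c.IsColinear γ.ofConv) (h1 : γ * γ' = 1) (h2 : γ' * γ = 1) :
    convMap (H ⊗[k] H) c.δ (convComap P (legFst k H H) γ * convComap P (legSnd k H H) γ *
        convComap P (mulHom k H) γ') =
      convMap (H ⊗[k] H) (incl k H P) (convComap P (legFst k H H) γ *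
        convComap P (legSnd k H H) γ * convComap P (mulHom k H) γ') := by
  have hγ' := (c.isColinear_iff _).1 hγ
  rw [toConv_ofConv] at hγ'
  have h3 := congrArg (convComap (P ⊗[k] H) (mulHom k H))
    (convRight_mul_convRightAntipode (k := k) (H := H) P)
  rw [map_mul, map_one, convComap_mulHom_convRight] at h3
  have h4 := convComap_legFst_convRight_commute γ
  simp only [map_mul, convMap_convComap, hγ', c.convMap_δ_inverse hγ h1 h2]
  generalize convComap (P ⊗[k] H) (legFst k H H) (convRight k H P) = r1 at *
  generalize convComap (P ⊗[k] H) (legSnd k H H) (convRight k H P) = r2 at *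
  generalize convComap (P ⊗[k] H) (mulHom k H) (convRightAntipode k H P) = r3 at *
  generalize convComap (P ⊗[k] H) (legSnd k H H) (convMap H (incl k H P) γ) = g2 at *
  generalize convComap (P ⊗[k] H) (legFst k H H) (convMap H (incl k H P) γ) = g1 at *
  generalize convComap (P ⊗[k] H) (mulHom k H) (convMap H (incl k H P) γ') = g3 at *
  calc g1 * r1 * (g2 * r2) * (r3 * g3) = g1 * (r1 * g2) * r2 * r3 * g3 := by
        simp only [mul_assoc]
    _ = g1 * g2 * (r1 * r2 * r3) * g3 := by rw [h4.eq]; simp only [mul_assoc]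
    _ = _ := by rw [h3, mul_one]

end Coaction

namespace Coaction

open WithConv Coalgebra HopfAlgebra

variable {k : Type*} [Field k] {H : Type*} [Ring H] [HopfAlgebra k H]
variable {P : Type*} [Ring P] [Algebra k P] (c : Coaction k H P)
variable {A : Type*} [Ring A] [Algebra k A] {σ : A →ₐ[k] P}

variable {γ γ' : WithConv (H →ₗ[k] P)}

/-- The measuring `h · a = γ(h₁) a γ⁻¹(h₂)` of the coinvariants. -/
theorem exists_measuring (hσ : Function.Injective σ) (hr : σ.range = c.coinvariants)
    (hγ : c.IsColinear γ.ofConv) (h1 : γ * γ' = 1) (h2 : γ' * γ = 1) :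
    ∃ act : H →ₗ[k] A →ₗ[k] A,
      ∀ a, convMap H σ (toConv (act.flip a)) = γ * convConst k H (σ a) * γ' := by
  have hmem (a : A) : σ a ∈ c.coinvariants := hr ▸ ⟨a, rfl⟩
  choose f hf using fun a : A =>
    c.exists_convMap_eq hσ hr _ (c.convMap_δ_conj hγ h1 h2 (hmem a))
  have hinj := convMap_injective (C := H) σ hσ
  have hadd (a b : A) : f (a + b) = f a + f b := by
    apply hinj
    rw [map_add, hf, hf, hf, map_add, map_add, mul_add, add_mul]
  have hsmul (r : k) (a : A) : f (r • a) = r • f a := by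
    have hs : convConst k H (σ (r • a)) = r • convConst k H (σ a) := by
      ext h
      simp [smul_comm r]
    have hs' : convMap H σ (r • f a) = r • convMap H σ (f a) := by
      ext h
      simp
    apply hinj
    rw [hs', hf, hf, hs, mul_smul_comm, smul_mul_assoc]
  let F : A →ₗ[k] H →ₗ[k] A :=
    { toFun := fun a => (f a).ofConv
      map_add' := fun a b => by rw [hadd, ofConv_add]
      map_smul' := fun r a => by rw [hsmul, ofConv_smul, RingHom.id_apply] }
  refine ⟨F.flip, fun a => ?_⟩
  rw [LinearMap.flip_flip]
  exact hf a

/-- The coalgebra morphism `h ⊗ (l ⊗ m) ↦ ε(m) h ⊗ l`. -/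
def legsFstSnd (k H : Type*) [Field k] [Ring H] [HopfAlgebra k H] :
    H ⊗[k] (H ⊗[k] H) →ₗc[k] H ⊗[k] H :=
  Coalgebra.TensorProduct.map (.id k H) (legFst k H H)

/-- The coalgebra morphism `h ⊗ (l ⊗ m) ↦ h ⊗ l m`. -/
def mulSndThd (k H : Type*) [Field k] [Ring H] [HopfAlgebra k H] :
    H ⊗[k] (H ⊗[k] H) →ₗc[k] H ⊗[k] H :=
  Coalgebra.TensorProduct.map (.id k H) (mulHom k H)

/-- The coalgebra morphism `h ⊗ (l ⊗ m) ↦ h l ⊗ m`. -/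
def mulFstSnd (k H : Type*) [Field k] [Ring H] [HopfAlgebra k H] :
    H ⊗[k] (H ⊗[k] H) →ₗc[k] H ⊗[k] H :=
  (Coalgebra.TensorProduct.map (mulHom k H) (.id k H)).comp
    (Coalgebra.TensorProduct.assoc k k H H H).symm.toCoalgHom

@[simp] theorem legsFstSnd_tmul (h l m : H) :
    legsFstSnd k H (h ⊗ₜ (l ⊗ₜ m)) = h ⊗ₜ (Coalgebra.counit (R := k) m • l) := by
  simp [legsFstSnd, TensorProduct.tmul_smul]

@[simp] theorem mulSndThd_tmul (h l m : H) :
    mulSndThd k H (h ⊗ₜ (l ⊗ₜ m)) = h ⊗ₜ (l * m) := by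
  simp [mulSndThd]

@[simp] theorem mulFstSnd_tmul (h l m : H) :
    mulFstSnd k H (h ⊗ₜ (l ⊗ₜ m)) = (h * l) ⊗ₜ m := by
  simp [mulFstSnd]

theorem convComap_mul_cancel {C D : Type*} [AddCommMonoid C] [Module k C] [Coalgebra k C]
    [AddCommMonoid D] [Module k D] [Coalgebra k D] {f f' : WithConv (C →ₗ[k] P)}
    (h : f * f' = 1) (g : D →ₗc[k] C) (F : WithConv (D →ₗ[k] P)) :
    convComap P g f * (convComap P g f' * F) = F := by
  rw [← mul_assoc, ← map_mul, h, map_one, one_mul]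

/-- A normalized cleaving map `γ` makes the coinvariants `A` a twisted `H`-module for the
measuring `h · a = γ(h₁) a γ⁻¹(h₂)` and the cocycle `h ⊗ l ↦ γ(h₁) γ(l₁) γ⁻¹(h₂ l₂)`. -/
theorem exists_crossedSystem (hσ : Function.Injective σ) (hr : σ.range = c.coinvariants)
    (hγ : c.IsTotalIntegral γ.ofConv) (h1 : γ * γ' = 1) (h2 : γ' * γ = 1) :
    ∃ s : CrossedSystem k H A,
      (∀ a, convMap H σ (toConv (s.act.flip a)) = γ * convConst k H (σ a) * γ') ∧
      convMap (H ⊗[k] H) σ (toConv s.coc) = convComap P (legFst k H H) γ *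
        convComap P (legSnd k H H) γ * convComap P (mulHom k H) γ' := by
  obtain ⟨act, hact⟩ := c.exists_measuring hσ hr hγ.colinear h1 h2
  have hδ := c.convMap_δ_cocycle hγ.colinear h1 h2
  obtain ⟨coc, hcoc⟩ := c.exists_convMap_eq hσ hr _ hδ
  set g1 := convComap P (legFst k H H) γ
  set g1' := convComap P (legFst k H H) γ'
  set g2 := convComap P (legSnd k H H) γ
  set g2' := convComap P (legSnd k H H) γ'
  set gm := convComap P (mulHom k H) γ
  set gm' := convComap P (mulHom k H) γ'
  have cancel := convComap_mul_cancel (D := H ⊗[k] H) h1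
  have cancel' := convComap_mul_cancel (D := H ⊗[k] H) h2
  have hFG : (g1 * g2 * gm') * (gm * g2' * g1') = 1 := by
    simp only [mul_assoc]
    rw [cancel', cancel, ← map_mul, h1, map_one]
  have hGF : (gm * g2' * g1') * (g1 * g2 * gm') = 1 := by
    simp only [mul_assoc]
    rw [cancel', cancel', ← map_mul, h1, map_one]
  obtain ⟨coc', hcoc'⟩ := c.exists_convMap_eq hσ hr _
    (c.convMap_δ_eq_of_inverse hFG hGF hδ)
  have hγ1 : γ 1 = 1 := hγ.map_one
  have hγ'1 : γ' 1 = 1 := by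
    have := convOne_eval_one γ γ'
    rw [h1, hγ1, one_mul] at this
    simpa using this.symm
  have hinj1 := convMap_injective (C := H) σ hσ
  have hinj2 := convMap_injective (C := H ⊗[k] H) σ hσ
  have hinj3 := convMap_injective (C := H ⊗[k] (H ⊗[k] H)) σ hσ
  have hact' (h : H) (a : A) : σ (act h a) = (γ * convConst k H (σ a) * γ') h :=
    congrArg (fun F : WithConv (H →ₗ[k] P) => F h) (hact a)
  refine ⟨{ act := act, coc := coc.ofConv, act_one := ?_, act_mul := ?_, isUnit_coc := ?_,
            one_act := ?_, act_act := ?_, coc_one := ?_, one_coc := ?_, cocycle := ?_ },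
          hact, hcoc⟩
  · intro h
    apply hσ
    rw [hact', map_one, map_one, mul_one, h1]
    simp
  · intro a b
    apply hinj1
    rw [map_mul (convMap H σ), hact, hact, hact, map_mul σ, map_mul (convConst k H)]
    simp only [mul_assoc]
    rw [← mul_assoc γ' γ, h2, one_mul]
  · refine ⟨⟨coc, coc', ?_, ?_⟩, rfl⟩
    · apply hinj2
      rw [map_mul, hcoc, hcoc', hFG, map_one]
    · apply hinj2
      rw [map_mul, hcoc, hcoc', hGF, map_one]
  · intro a
    apply hσ
    rw [hact', convOne_eval_one, mul_convConst_apply, hγ1, hγ'1, one_mul, mul_one]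
  · intro a
    have e1 : convMap (H ⊗[k] H) σ
        (toConv (TensorProduct.lift act ∘ₗ (act.flip a).lTensor H)) =
        g1 * (g2 * convConst k (H ⊗[k] H) (σ a) * g2') * g1' := by
      have e := congrArg (convComap P (legSnd k H H)) (hact a)
      rw [map_mul, map_mul, convComap_convConst] at e
      rw [← e]
      apply WithConv.ext
      apply TensorProduct.ext'
      intro h l
      refine Eq.trans ?_ (convComap_legFst_legSnd_legFst_apply _ _ _ h l).symm
      exact hact' h (act l a)
    have e2 : convMap (H ⊗[k] H) σ (toConv (act.flip a ∘ₗ LinearMap.mul' k H)) =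
        gm * convConst k (H ⊗[k] H) (σ a) * gm' := by
      have e := congrArg (convComap P (mulHom k H)) (hact a)
      rw [map_mul, map_mul, convComap_convConst] at e
      exact e
    apply hinj2
    rw [map_mul, map_mul, e1, e2, toConv_ofConv, hcoc]
    simp only [mul_assoc]
    rw [cancel', cancel', cancel']
  · intro h
    apply hσ
    have e1 : convComap P (tmulOne k H) g1 = γ := by
      ext h
      simp [g1]
    have e2 : convComap P (tmulOne k H) g2 = 1 := by
      ext h
      simp [g2, hγ1, Algebra.algebraMap_eq_smul_one]
    have e3 : convComap P (tmulOne k H) gm' = γ' := by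
      ext h
      simp [gm']
    have e : σ (coc (h ⊗ₜ 1)) = convComap P (tmulOne k H) (g1 * g2 * gm') h := by
      rw [← hcoc]
      rfl
    rw [e, map_mul, map_mul, e1, e2, e3, mul_one, h1]
    simp
  · intro h
    apply hσ
    have e1 : convComap P (oneTmul k H) g1 = 1 := by
      ext h
      simp [g1, hγ1, Algebra.algebraMap_eq_smul_one]
    have e2 : convComap P (oneTmul k H) g2 = γ := by
      ext h
      simp [g2]
    have e3 : convComap P (oneTmul k H) gm' = γ' := by
      ext h
      simp [gm']
    have e : σ (coc (1 ⊗ₜ h)) = convComap P (oneTmul k H) (g1 * g2 * gm') h := by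
      rw [← hcoc]
      rfl
    rw [e, map_mul, map_mul, e1, e2, e3, one_mul, h1]
    simp
  · have e1 : convMap _ σ (toConv (TensorProduct.lift act ∘ₗ coc.ofConv.lTensor H)) =
        convComap P (legFst k H (H ⊗[k] H)) γ *
          convComap P (legSnd k H (H ⊗[k] H)) (g1 * g2 * gm') *
          convComap P (legFst k H (H ⊗[k] H)) γ' := by
      rw [← hcoc]
      apply WithConv.ext
      apply TensorProduct.ext'
      intro h x
      refine Eq.trans ?_ (convComap_legFst_legSnd_legFst_apply _ _ _ h x).symm
      exact hact' h (coc x)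
    have e2 : convMap _ σ (toConv (coc.ofConv ∘ₗ (LinearMap.mul' k H).lTensor H)) =
        convComap P (mulSndThd k H) (g1 * g2 * gm') := by
      rw [← hcoc]
      rfl
    have e3 : convMap _ σ (toConv (coc.ofConv ∘ₗ ((TensorProduct.rid k H).toLinearMap ∘ₗ
          (Coalgebra.counit (R := k) (A := H)).lTensor H).lTensor H)) =
        convComap P (legsFstSnd k H) (g1 * g2 * gm') := by
      rw [← hcoc]
      rfl
    have e4 : convMap _ σ (toConv (coc.ofConv ∘ₗ (LinearMap.mul' k H).rTensor H ∘ₗ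
          (TensorProduct.assoc k H H H).symm.toLinearMap)) =
        convComap P (mulFstSnd k H) (g1 * g2 * gm') := by
      rw [← hcoc]
      rfl
    have ext3 {F G : WithConv (H ⊗[k] (H ⊗[k] H) →ₗ[k] P)}
        (h : ∀ x y z, F (x ⊗ₜ (y ⊗ₜ z)) = G (x ⊗ₜ (y ⊗ₜ z))) : F = G := by
      apply WithConv.ext
      ext x y z
      exact h x y z
    -- the maps `γ(h)`, `γ(l)`, `γ(m)`, `γ(h l)`, `γ(l m)`, `γ(h l m)` of `h ⊗ l ⊗ m`
    have a1 : convComap P (mulSndThd k H) g1 = convComap P (legFst k H (H ⊗[k] H)) γ :=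
      ext3 fun x y z => by simp [g1, mul_comm]
    have a2 : convComap P (mulSndThd k H) g2 = convComap P (legSnd k H (H ⊗[k] H)) gm :=
      ext3 fun x y z => by simp [g2, gm]
    have a3 : convComap P (legsFstSnd k H) g1 = convComap P (legFst k H (H ⊗[k] H)) γ :=
      ext3 fun x y z => by simp [g1, smul_smul]
    have a4 : convComap P (legsFstSnd k H) g2 = convComap P (legSnd k H (H ⊗[k] H)) g1 :=
      ext3 fun x y z => by simp [g1, g2, smul_smul, mul_comm]
    have a5 : convComap P (mulFstSnd k H) g1 = convComap P (legsFstSnd k H) gm :=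
      ext3 fun x y z => by simp [g1, gm]
    have a6 : convComap P (mulFstSnd k H) g2 =
        convComap P (legSnd k H (H ⊗[k] H)) g2 :=
      ext3 fun x y z => by simp [g2, smul_smul]
    have a7 : convComap P (mulFstSnd k H) gm' = convComap P (mulSndThd k H) gm' :=
      ext3 fun x y z => by simp [gm', mul_assoc]
    have hm : gm' * gm = 1 := by rw [← map_mul, h2, map_one]
    apply hinj3
    rw [map_mul, map_mul, e1, e2, e3, e4]
    simp only [map_mul, a1, a2, a3, a4, a5, a6, a7]
    simp only [mul_assoc]
    rw [convComap_mul_cancel h2, convComap_mul_cancel hm, convComap_mul_cancel hm]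

end Coaction

/-! ### Convolution invertibility and bijectivity -/

section RightConv

open WithConv Coalgebra

variable {k : Type*} [Field k] {R : Type*} [Ring R] [Algebra k R]
variable {C : Type*} [AddCommGroup C] [Module k C] [Coalgebra k C]

/-- The map `a ⊗ x ↦ a f(x₁) ⊗ x₂` on `R ⊗ C` defined by an element `f` of the convolution
algebra `Hom(C, R)`. -/
def rightConv (f : WithConv (C →ₗ[k] R)) : R ⊗[k] C →ₗ[k] R ⊗[k] C :=
  (LinearMap.mul' k R).rTensor C ∘ₗ (TensorProduct.assoc k R R C).symm.toLinearMap ∘ₗ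
    (f.ofConv.rTensor C ∘ₗ comul).lTensor R

theorem rightConv_tmul (f : WithConv (C →ₗ[k] R)) (a : R) (x : C) :
    rightConv f (a ⊗ₜ x) =
      (LinearMap.mulLeft k a).rTensor C (f.ofConv.rTensor C (comul (R := k) x)) := by
  simp only [rightConv, LinearMap.comp_apply, LinearMap.lTensor_tmul, LinearEquiv.coe_coe]
  induction f.ofConv.rTensor C (comul (R := k) x) with
  | zero => simp
  | add u v hu hv => simp only [TensorProduct.tmul_add, map_add, hu, hv]
  | tmul u v => simp

theorem rightConv_mulLeft (f : WithConv (C →ₗ[k] R)) (a : R) (z : R ⊗[k] C) :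
    rightConv f ((LinearMap.mulLeft k a).rTensor C z) =
      (LinearMap.mulLeft k a).rTensor C (rightConv f z) := by
  induction z with
  | zero => simp
  | add u v hu hv => simp only [map_add, hu, hv]
  | tmul u v =>
    rw [LinearMap.rTensor_tmul, rightConv_tmul, rightConv_tmul, LinearMap.mulLeft_apply,
      LinearMap.mulLeft_mul, LinearMap.rTensor_comp, LinearMap.comp_apply]

theorem rightConv_mul (f g : WithConv (C →ₗ[k] R)) :
    rightConv (f * g) = rightConv g ∘ₗ rightConv f := by
  have key (x : C) : rightConv g (f.ofConv.rTensor C (comul (R := k) x)) =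
      (f * g).ofConv.rTensor C (comul (R := k) x) := by
    have h1 : rightConv g ∘ₗ f.ofConv.rTensor C =
        (LinearMap.mul' k R ∘ₗ TensorProduct.map f.ofConv g.ofConv).rTensor C ∘ₗ
          (TensorProduct.assoc k C C C).symm.toLinearMap ∘ₗ comul.lTensor C := by
      ext a b
      simp only [TensorProduct.AlgebraTensorModule.curry_apply, TensorProduct.curry_apply,
        LinearMap.coe_restrictScalars, LinearMap.comp_apply, LinearMap.rTensor_tmul,
        LinearMap.lTensor_tmul, LinearEquiv.coe_coe, rightConv_tmul]
      induction comul (R := k) b with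
      | zero => simp
      | add u v hu hv => simp only [TensorProduct.tmul_add, map_add, hu, hv]
      | tmul u v => simp
    have h2 := LinearMap.congr_fun h1 (comul (R := k) x)
    simp only [LinearMap.comp_apply, LinearEquiv.coe_coe, coassoc_symm_apply] at h2
    rw [h2, ← LinearMap.comp_apply (LinearMap.rTensor C _), ← LinearMap.rTensor_comp]
    rfl
  ext a x
  simp only [TensorProduct.AlgebraTensorModule.curry_apply, TensorProduct.curry_apply,
    LinearMap.coe_restrictScalars, LinearMap.comp_apply]
  rw [rightConv_tmul, rightConv_tmul, rightConv_mulLeft, key]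

theorem rid_lTensor_counit_rightConv (f : WithConv (C →ₗ[k] R)) (x : C) :
    TensorProduct.rid k R ((counit (R := k) (A := C)).lTensor R (rightConv f (1 ⊗ₜ x))) = f x := by
  have h : (TensorProduct.rid k R).toLinearMap ∘ₗ (counit (R := k) (A := C)).lTensor R ∘ₗ
      f.ofConv.rTensor C =
      f.ofConv ∘ₗ (TensorProduct.rid k C).toLinearMap ∘ₗ (counit (R := k) (A := C)).lTensor C := by
    ext a b
    simp
  have h' := LinearMap.congr_fun h (comul (R := k) x)
  simp only [LinearMap.comp_apply, LinearEquiv.coe_coe, lTensor_counit_comul,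
    TensorProduct.rid_tmul, one_smul] at h'
  rw [rightConv_tmul]
  simpa using h'

theorem rightConv_one : rightConv (1 : WithConv (C →ₗ[k] R)) = .id := by
  ext a x
  simp only [TensorProduct.AlgebraTensorModule.curry_apply, TensorProduct.curry_apply,
    LinearMap.coe_restrictScalars, LinearMap.id_apply]
  have h : (1 : WithConv (C →ₗ[k] R)).ofConv.rTensor C =
      (Algebra.linearMap k R).rTensor C ∘ₗ (counit (R := k) (A := C)).rTensor C := by
    rw [← LinearMap.rTensor_comp]
    rfl
  rw [rightConv_tmul, h, LinearMap.comp_apply, rTensor_counit_comul]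
  simp

theorem rightConv_injective :
    Function.Injective (rightConv : WithConv (C →ₗ[k] R) → R ⊗[k] C →ₗ[k] R ⊗[k] C) := by
  intro f g h
  ext x
  rw [← rid_lTensor_counit_rightConv, h, rid_lTensor_counit_rightConv]

theorem rightConv_bijective {f : WithConv (C →ₗ[k] R)} (hf : IsUnit f) :
    Function.Bijective (rightConv f) := by
  obtain ⟨u, rfl⟩ := hf
  refine Function.bijective_iff_has_inverse.2 ⟨rightConv (↑u⁻¹ : WithConv (C →ₗ[k] R)), ?_, ?_⟩
  · intro z
    rw [← LinearMap.comp_apply, ← rightConv_mul, Units.mul_inv, rightConv_one, LinearMap.id_apply]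
  · intro z
    rw [← LinearMap.comp_apply, ← rightConv_mul, Units.inv_mul, rightConv_one, LinearMap.id_apply]

/-- A convolution inverse of `f` is obtained from the inverse of `a ⊗ x ↦ a f(x₁) ⊗ x₂`, which is
left `R`-linear, by evaluation at `1 ⊗ x`. -/
theorem isUnit_of_rightConv_bijective {f : WithConv (C →ₗ[k] R)}
    (hf : Function.Bijective (rightConv f)) : IsUnit f := by
  let e := LinearEquiv.ofBijective (rightConv f) hf
  have he (z : R ⊗[k] C) : rightConv f (e.symm z) = z := e.apply_symm_apply z
  have hlin (a : R) (z : R ⊗[k] C) : e.symm ((LinearMap.mulLeft k a).rTensor C z) =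
      (LinearMap.mulLeft k a).rTensor C (e.symm z) := by
    apply hf.1
    rw [he, rightConv_mulLeft, he]
  let ev : R ⊗[k] C →ₗ[k] R :=
    (TensorProduct.rid k R).toLinearMap ∘ₗ (counit (R := k) (A := C)).lTensor R
  have hev (a : R) (z : R ⊗[k] C) : ev ((LinearMap.mulLeft k a).rTensor C z) = a * ev z := by
    induction z with
    | zero => simp
    | add u v hu hv => simp only [map_add, hu, hv, mul_add]
    | tmul u v => simp [ev]
  let g : WithConv (C →ₗ[k] R) := toConv (ev ∘ₗ e.symm.toLinearMap ∘ₗ TensorProduct.mk k R C 1)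
  have hfg : f * g = 1 := by
    have h : LinearMap.mul' k R ∘ₗ TensorProduct.map f.ofConv g.ofConv =
        ev ∘ₗ e.symm.toLinearMap ∘ₗ f.ofConv.rTensor C := by
      ext a b
      have h1 : (f.ofConv a) ⊗ₜ[k] b =
          (LinearMap.mulLeft k (f.ofConv a)).rTensor C (1 ⊗ₜ b) := by simp
      simp only [TensorProduct.AlgebraTensorModule.curry_apply, TensorProduct.curry_apply,
        LinearMap.coe_restrictScalars, LinearMap.comp_apply, LinearMap.rTensor_tmul,
        LinearEquiv.coe_coe]
      rw [h1, hlin, hev]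
      simp [g]
    ext x
    have h2 := LinearMap.congr_fun h (comul (R := k) x)
    have h3 : f.ofConv.rTensor C (comul (R := k) x) = rightConv f (1 ⊗ₜ x) := by
      rw [rightConv_tmul]
      simp
    have h4 : e.symm (rightConv f (1 ⊗ₜ[k] x)) = 1 ⊗ₜ x := e.symm_apply_apply _
    refine h2.trans ?_
    change ev (e.symm (f.ofConv.rTensor C (comul (R := k) x))) = _
    rw [h3, h4]
    simp [ev, Algebra.algebraMap_eq_smul_one]
  have hgf : g * f = 1 := by
    apply rightConv_injective
    rw [rightConv_mul, rightConv_one]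
    have h1 : rightConv g ∘ₗ rightConv f = .id := by rw [← rightConv_mul, hfg, rightConv_one]
    refine LinearMap.ext fun z => ?_
    obtain ⟨y, rfl⟩ := hf.2 z
    have := LinearMap.congr_fun h1 y
    simp only [LinearMap.comp_apply, LinearMap.id_apply] at this ⊢
    rw [this]
  exact ⟨⟨f, g, hfg, hgf⟩, rfl⟩

end RightConv

/-! ### Trivializations by crossed products -/

section Trivialization

open WithConv Coalgebra HopfAlgebra

variable {k : Type*} [Field k] {H : Type*} [Ring H] [HopfAlgebra k H]
variable {A : Type*} [Ring A] [Algebra k A] {P : Type*} [Ring P] [Algebra k P]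

namespace CrossedSystem

variable (s : CrossedSystem k H A)

theorem twist_tmul (h l : H) : s.twist (h ⊗ₜ l) = ∑ i ∈ (ℛ k h).index,
    TensorProduct.map (s.coc ∘ₗ TensorProduct.mk k H H ((ℛ k h).left i))
      (LinearMap.mulLeft k ((ℛ k h).right i)) (comul (R := k) l) := by
  simp only [twist, LinearMap.comp_apply, TensorProduct.comul_tmul]
  conv_lhs => rw [← (ℛ k h).eq]
  simp only [TensorProduct.sum_tmul, map_sum]
  refine Finset.sum_congr rfl fun i _ => ?_
  induction comul (R := k) l with
  | zero => simp
  | add u v hu hv => simp only [TensorProduct.tmul_add, map_add, hu, hv]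
  | tmul u v => simp

theorem twist_one_tmul (l : H) : s.twist (1 ⊗ₜ l) = 1 ⊗ₜ l := by
  simp only [twist, LinearMap.comp_apply, TensorProduct.comul_tmul, Bialgebra.comul_one,
    Algebra.TensorProduct.one_def]
  rw [← (ℛ k l).eq]
  simp only [TensorProduct.tmul_sum, map_sum,
    TensorProduct.AlgebraTensorModule.tensorTensorTensorComm_tmul,
    TensorProduct.map_tmul, s.one_coc, LinearMap.mul'_apply, one_mul,
    Algebra.algebraMap_eq_smul_one, TensorProduct.smul_tmul]
  rw [← TensorProduct.tmul_sum, sum_counit_smul]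

/-- The linear isomorphism `Ω : A # H → P` is multiplicative and restricts to the algebra
morphism `σ` on `A`. -/
structure IsTrivialization (σ : A →ₐ[k] P) (Ω : (A ⊗[k] H) ≃ₗ[k] P) : Prop where
  map_mul : ∀ x y, Ω (s.mul (x ⊗ₜ y)) = Ω x * Ω y
  map_tmul_one : ∀ a, Ω (a ⊗ₜ 1) = σ a

variable {s} {σ : A →ₐ[k] P} {Ω : (A ⊗[k] H) ≃ₗ[k] P}

section

variable {γ : WithConv (H →ₗ[k] P)} (hΩ : ∀ a h, Ω (a ⊗ₜ h) = σ a * γ h)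
include hΩ

theorem apply_twist (z : H ⊗[k] H) : Ω (s.twist z) =
    (convMap (H ⊗[k] H) σ (toConv s.coc) * convComap P (mulHom k H) γ) z := by
  have h : Ω.toLinearMap ∘ₗ TensorProduct.map s.coc (LinearMap.mul' k H) =
      LinearMap.mul' k P ∘ₗ TensorProduct.map (convMap (H ⊗[k] H) σ (toConv s.coc)).ofConv
        (convComap P (mulHom k H) γ).ofConv :=
    TensorProduct.ext' fun x y => hΩ _ _
  exact LinearMap.congr_fun h (comul (R := k) z)

theorem apply_mulLeft_rTensor (a : A) (z : A ⊗[k] H) :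
    Ω ((LinearMap.mulLeft k a).rTensor H z) = σ a * Ω z := by
  induction z with
  | zero => simp
  | add u v hu hv => simp only [map_add, hu, hv, mul_add]
  | tmul u v => simp [hΩ, mul_assoc]

theorem apply_mul_tmul (a b : A) (h l : H) : Ω (s.mul ((a ⊗ₜ h) ⊗ₜ (b ⊗ₜ l))) =
    σ a * (convComap P (legFst k H H) (convMap H σ (toConv (s.act.flip b))) *
      (convMap (H ⊗[k] H) σ (toConv s.coc) * convComap P (mulHom k H) γ)) (h ⊗ₜ l) := by
  rw [mul_tmul, convMul_tmul_apply, map_sum, Finset.mul_sum]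
  refine Finset.sum_congr rfl fun i _ => ?_
  rw [apply_mulLeft_rTensor hΩ, apply_twist hΩ, map_mul, mul_assoc]
  refine congrArg (σ a * ·) ?_
  refine (congrArg (σ (s.act ((ℛ k h).left i) b) * ·) (sum_counit_left_smul
    ((convMap (H ⊗[k] H) σ (toConv s.coc) * convComap P (mulHom k H) γ).ofConv ∘ₗ
      TensorProduct.mk k H H ((ℛ k h).right i)) l).symm).trans ?_
  rw [Finset.mul_sum]
  refine Finset.sum_congr rfl fun j _ => ?_
  simp only [convComap_apply, legFst_tmul, map_smul, convMap_apply, mul_smul_comm, smul_mul_assoc]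
  rfl

end

/-- The map `h ↦ Ω(1 ⊗ h)`, as an element of the convolution algebra `Hom(H, P)`. -/
def cleaving (Ω : (A ⊗[k] H) ≃ₗ[k] P) : WithConv (H →ₗ[k] P) :=
  toConv (Ω.toLinearMap ∘ₗ TensorProduct.mk k A H 1)

namespace IsTrivialization

theorem apply_tmul (hΩ : s.IsTrivialization σ Ω) (a : A) (h : H) :
    Ω (a ⊗ₜ h) = σ a * cleaving Ω h := by
  have h1 : s.mul ((a ⊗ₜ 1) ⊗ₜ (1 ⊗ₜ h)) = a ⊗ₜ h := by
    simp [mul, swap, Bialgebra.comul_one, Algebra.TensorProduct.one_def, s.one_act,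
      s.twist_one_tmul]
  rw [← h1, hΩ.map_mul, hΩ.map_tmul_one]
  rfl

/-- `γ(h) σ(b) = σ(h₁ · b) γ(h₂)`. -/
theorem cleaving_mul_convConst (hΩ : s.IsTrivialization σ Ω) (b : A) :
    cleaving Ω * convConst k H (σ b) =
      convMap H σ (toConv (s.act.flip b)) * cleaving Ω := by
  have e1 : convComap P (tmulOne k H)
      (convComap P (legFst k H H) (convMap H σ (toConv (s.act.flip b)))) =
      convMap H σ (toConv (s.act.flip b)) := by
    ext h
    simp
  have e2 : convComap P (tmulOne k H) (convMap (H ⊗[k] H) σ (toConv s.coc)) = 1 := by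
    ext h
    simp [s.coc_one]
  have e3 : convComap P (tmulOne k H) (convComap P (mulHom k H) (cleaving Ω)) = cleaving Ω := by
    ext h
    simp
  ext h
  have h1 := apply_mul_tmul (s := s) hΩ.apply_tmul 1 b h 1
  rw [hΩ.map_mul, hΩ.map_tmul_one, map_one, one_mul] at h1
  rw [mul_convConst_apply]
  refine (h1.trans (convComap_apply (tmulOne k H) (_ * (_ * _)) h).symm).trans ?_
  rw [_root_.map_mul, _root_.map_mul, e1, e2, e3, one_mul]

/-- `γ(h) γ(l) = σ(coc(h₁, l₁)) γ(h₂ l₂)`. -/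
theorem cleaving_mul_cleaving (hΩ : s.IsTrivialization σ Ω) :
    convComap P (legFst k H H) (cleaving Ω) * convComap P (legSnd k H H) (cleaving Ω) =
      convMap (H ⊗[k] H) σ (toConv s.coc) * convComap P (mulHom k H) (cleaving Ω) := by
  have e1 : toConv (s.act.flip 1) = 1 := by
    ext h
    simp [s.act_one]
  apply WithConv.ext
  apply TensorProduct.ext'
  intro h l
  have h1 := apply_mul_tmul (s := s) hΩ.apply_tmul 1 1 h l
  rw [hΩ.map_mul, map_one, one_mul, e1, map_one, map_one, one_mul] at h1
  exact (convComap_legFst_mul_legSnd_apply _ _ h l).trans h1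

/-- The coaction `id ⊗ Δ` of the crossed product, transported along `Ω`. -/
def coactionMap (Ω : (A ⊗[k] H) ≃ₗ[k] P) : P →ₗ[k] P ⊗[k] H :=
  Ω.toLinearMap.rTensor H ∘ₗ freeCoaction k H A ∘ₗ Ω.symm.toLinearMap

theorem coactionMap_apply_tmul (Ω : (A ⊗[k] H) ≃ₗ[k] P) (a : A) (h : H) :
    coactionMap Ω (Ω (a ⊗ₜ h)) =
      (Ω.toLinearMap ∘ₗ TensorProduct.mk k A H a).rTensor H (comul (R := k) h) := by
  simp only [coactionMap, freeCoaction, LinearMap.comp_apply, LinearEquiv.coe_coe,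
    LinearEquiv.symm_apply_apply, LinearMap.lTensor_tmul]
  induction comul (R := k) h with
  | zero => simp
  | add u v hu hv => simp only [TensorProduct.tmul_add, map_add, hu, hv]
  | tmul u v => simp

variable (k H P) in
/-- The element `h ↦ γ(h₁) ⊗ h₂` of the convolution algebra `Hom(H, P ⊗ H)`. -/
def colift (γ : WithConv (H →ₗ[k] P)) : WithConv (H →ₗ[k] P ⊗[k] H) :=
  convMap H (Coaction.incl k H P) γ * convRight k H P

theorem colift_apply (γ : WithConv (H →ₗ[k] P)) (h : H) :
    colift k H P γ h = γ.ofConv.rTensor H (comul (R := k) h) := by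
  rw [colift, (ℛ k h).convMul_apply, ← (ℛ k h).eq]
  simp

theorem coactionMap_mul_cleaving (hΩ : s.IsTrivialization σ Ω) (a : A) (h : H) :
    coactionMap Ω (σ a * cleaving Ω h) =
      Coaction.incl k H P (σ a) * colift k H P (cleaving Ω) h := by
  rw [← hΩ.apply_tmul, coactionMap_apply_tmul, colift_apply, ← (ℛ k h).eq]
  simp [Finset.mul_sum, hΩ.apply_tmul]

/-- `coactionMap` is multiplicative on products of elements `σ(a) γ(h)`. -/
theorem coactionMap_mul_tmul (hΩ : s.IsTrivialization σ Ω) (a b : A) (h l : H) :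
    coactionMap Ω (Ω (a ⊗ₜ h) * Ω (b ⊗ₜ l)) =
      coactionMap Ω (Ω (a ⊗ₜ h)) * coactionMap Ω (Ω (b ⊗ₜ l)) := by
  set i := Coaction.incl k H P with hi
  set γ := cleaving Ω
  set E : WithConv (H ⊗[k] H →ₗ[k] A) :=
    convComap A (legFst k H H) (toConv (s.act.flip b)) * toConv s.coc
  have hlin (x : H ⊗[k] H) : coactionMap Ω (σ a * (convMap _ σ E * convComap P (mulHom k H) γ) x) =
      i (σ a) * (convMap _ (i.comp σ) E *
        convComap (P ⊗[k] H) (mulHom k H) (colift k H P γ)) x := by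
    have h1 : coactionMap Ω ∘ₗ LinearMap.mulLeft k (σ a) ∘ₗ LinearMap.mul' k P ∘ₗ
        TensorProduct.map (convMap _ σ E).ofConv (convComap P (mulHom k H) γ).ofConv =
        LinearMap.mulLeft k (i (σ a)) ∘ₗ LinearMap.mul' k (P ⊗[k] H) ∘ₗ
        TensorProduct.map (convMap _ (i.comp σ) E).ofConv
          (convComap (P ⊗[k] H) (mulHom k H) (colift k H P γ)).ofConv := by
      refine TensorProduct.ext' fun x y => ?_
      have h2 := hΩ.coactionMap_mul_cleaving (a * E x) (mulHom k H y)
      rw [_root_.map_mul σ, _root_.map_mul (Coaction.incl k H P), mul_assoc, mul_assoc] at h2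
      exact h2
    exact LinearMap.congr_fun h1 (comul (R := k) x)
  have h1 : Ω (a ⊗ₜ h) * Ω (b ⊗ₜ l) =
      σ a * (convMap _ σ E * convComap P (mulHom k H) γ) (h ⊗ₜ l) := by
    rw [← hΩ.map_mul, apply_mul_tmul hΩ.apply_tmul, _root_.map_mul (convMap _ σ), mul_assoc]
    rfl
  have h2 : convMap _ (i.comp σ) E * convComap (P ⊗[k] H) (mulHom k H) (colift k H P γ) =
      convComap (P ⊗[k] H) (legFst k H H) (colift k H P γ * convConst k H (i (σ b))) *
        convComap (P ⊗[k] H) (legSnd k H H) (colift k H P γ) := by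
    have h3 := congrArg (convMap (H ⊗[k] H) i) hΩ.cleaving_mul_cleaving
    have h4 := congrArg (fun F => convComap (P ⊗[k] H) (legFst k H H) (convMap H i F))
      (hΩ.cleaving_mul_convConst b)
    simp only [_root_.map_mul, convMap_convComap, convMap_convConst] at h3 h4
    have h5 := (convComap_legFst_convRight_commute γ).eq
    have h6 : convConst k H (i (σ b)) * convRight k H P =
        convRight k H P * convConst k H (i (σ b)) := convConst_mul_convRight (σ b)
    replace h6 := congrArg (convComap (P ⊗[k] H) (legFst k H H)) h6
    have h7 : convMap (H ⊗[k] H) (i.comp σ) E = convComap (P ⊗[k] H) (legFst k H H)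
        (convMap H i (convMap H σ (toConv (s.act.flip b)))) *
        convMap (H ⊗[k] H) i (convMap (H ⊗[k] H) σ (toConv s.coc)) := by
      rw [_root_.map_mul]
      rfl
    rw [h7]
    simp only [colift, _root_.map_mul, convComap_mulHom_convRight, ← hi] at h5 h6 ⊢
    generalize convComap (P ⊗[k] H) (legFst k H H) (convRight k H P) = r1 at *
    generalize convComap (P ⊗[k] H) (legSnd k H H) (convRight k H P) = r2 at *
    generalize convComap (P ⊗[k] H) (legFst k H H) (convConst k H (i (σ b))) = cb at *
    generalize convComap (P ⊗[k] H) (legFst k H H) (convMap H i γ) = g1 at *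
    generalize convComap (P ⊗[k] H) (legSnd k H H) (convMap H i γ) = g2 at *
    generalize convComap (P ⊗[k] H) (mulHom k H) (convMap H i γ) = gm at *
    generalize convMap (H ⊗[k] H) i (convMap (H ⊗[k] H) σ (toConv s.coc)) = cc at *
    generalize convComap (P ⊗[k] H) (legFst k H H)
        (convMap H i (convMap H σ (toConv (s.act.flip b)))) = ac at *
    calc ac * cc * (gm * (r1 * r2)) = ac * (cc * gm) * r1 * r2 := by simp only [mul_assoc]
      _ = ac * g1 * (g2 * r1) * r2 := by rw [← h3]; simp only [mul_assoc]
      _ = g1 * (cb * r1) * g2 * r2 := by rw [← h4, ← h5]; simp only [mul_assoc]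
      _ = _ := by rw [h6]; simp only [mul_assoc]
  rw [h1, hlin, h2, hΩ.apply_tmul, hΩ.apply_tmul, hΩ.coactionMap_mul_cleaving,
    hΩ.coactionMap_mul_cleaving]
  rw [convComap_legFst_mul_legSnd_apply, mul_convConst_apply]
  simp only [mul_assoc]
  rfl

end IsTrivialization

end CrossedSystem

end Trivialization

namespace CrossedSystem.IsTrivialization

open WithConv Coalgebra HopfAlgebra

variable {k : Type*} [Field k] {H : Type*} [Ring H] [HopfAlgebra k H]
variable {A : Type*} [Ring A] [Algebra k A] {P : Type*} [Ring P] [Algebra k P]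
variable {s : CrossedSystem k H A} {σ : A →ₐ[k] P} {Ω : (A ⊗[k] H) ≃ₗ[k] P}

theorem coactionMap_one (hΩ : s.IsTrivialization σ Ω) : coactionMap Ω 1 = 1 := by
  have h : Ω (1 ⊗ₜ 1) = 1 := by rw [hΩ.map_tmul_one, map_one]
  rw [← h, coactionMap_apply_tmul, Bialgebra.comul_one, Algebra.TensorProduct.one_def,
    LinearMap.rTensor_tmul, LinearMap.comp_apply, TensorProduct.mk_apply, LinearEquiv.coe_coe, h,
    Algebra.TensorProduct.one_def]

theorem coactionMap_mul (hΩ : s.IsTrivialization σ Ω) (p q : P) :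
    coactionMap Ω (p * q) = coactionMap Ω p * coactionMap Ω q := by
  obtain ⟨x, rfl⟩ := Ω.surjective p
  obtain ⟨y, rfl⟩ := Ω.surjective q
  induction x with
  | zero => simp
  | add x x' hx hx' => simp only [map_add, add_mul, hx, hx']
  | tmul a h =>
    induction y with
    | zero => simp
    | add y y' hy hy' => simp only [map_add, mul_add, hy, hy']
    | tmul b l => exact hΩ.coactionMap_mul_tmul a b h l

/-- The coaction on `P` that corresponds to `id ⊗ Δ` on the crossed product. -/
def coaction (hΩ : s.IsTrivialization σ Ω) : Coaction k H P where
  δ := AlgHom.ofLinearMap (coactionMap Ω) hΩ.coactionMap_one hΩ.coactionMap_mul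
  coassoc p := by
    obtain ⟨x, rfl⟩ := Ω.surjective p
    change TensorProduct.assoc k P H H ((coactionMap Ω).rTensor H (coactionMap Ω (Ω x))) =
      comul.lTensor P (coactionMap Ω (Ω x))
    induction x with
    | zero => simp
    | add x y hx hy => simp only [map_add, hx, hy]
    | tmul a h =>
      set W : H →ₗ[k] P := Ω.toLinearMap ∘ₗ TensorProduct.mk k A H a
      have h1 : coactionMap Ω ∘ₗ W = W.rTensor H ∘ₗ comul :=
        LinearMap.ext fun x => coactionMap_apply_tmul Ω a x
      have h2 : (TensorProduct.assoc k P H H).toLinearMap ∘ₗ (W.rTensor H).rTensor H =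
          W.rTensor (H ⊗[k] H) ∘ₗ (TensorProduct.assoc k H H H).toLinearMap := by
        ext x y z
        simp
      have h3 := LinearMap.congr_fun h2 ((comul (R := k)).rTensor H (comul (R := k) h))
      simp only [LinearMap.comp_apply, LinearEquiv.coe_coe, coassoc_apply] at h3
      rw [coactionMap_apply_tmul, ← LinearMap.rTensor_comp_apply, h1,
        LinearMap.rTensor_comp_apply, h3,
        ← LinearMap.comp_apply, LinearMap.rTensor_comp_lTensor, ← LinearMap.lTensor_comp_rTensor]
      rfl
  counit p := by
    obtain ⟨x, rfl⟩ := Ω.surjective p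
    simp only [AlgHom.ofLinearMap_apply]
    induction x with
    | zero => simp
    | add x y hx hy => simp only [map_add, hx, hy]
    | tmul a h =>
      rw [coactionMap_apply_tmul, ← LinearMap.comp_apply, LinearMap.lTensor_comp_rTensor,
        ← LinearMap.rTensor_comp_lTensor, LinearMap.comp_apply, lTensor_counit_comul]
      simp

theorem coaction_δ (hΩ : s.IsTrivialization σ Ω) (p : P) :
    hΩ.coaction.δ p = Ω.toLinearMap.rTensor H (freeCoaction k H A (Ω.symm p)) := rfl

theorem isColinear_cleaving (hΩ : s.IsTrivialization σ Ω) :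
    hΩ.coaction.IsColinear (cleaving Ω).ofConv :=
  fun h => coactionMap_apply_tmul Ω 1 h

/-- With `B(l ⊗ h) = l h₁ ⊗ h₂`, the identity `γ(l) γ(h) = σ(coc(l₁, h₁)) γ(l₂ h₂)` expresses
`rightConv γ` through `rightConv coc` and `B`. -/
theorem rightConv_cleaving (hΩ : s.IsTrivialization σ Ω) (z : A ⊗[k] (H ⊗[k] H)) :
    rightConv (cleaving Ω) (Ω.toLinearMap.rTensor H ((TensorProduct.assoc k A H H).symm z)) =
      Ω.toLinearMap.rTensor H ((TensorProduct.assoc k A H H).symm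
        ((rightConv (toConv (.id : H →ₗ[k] H))).lTensor A (rightConv (toConv s.coc) z))) := by
  have key (l h : H) : (TensorProduct.assoc k A H H).symm
      ((rightConv (toConv (.id : H →ₗ[k] H))).lTensor A
        (s.coc.rTensor (H ⊗[k] H) (comul (R := k) (l ⊗ₜ[k] h)))) =
      (s.twist ∘ₗ TensorProduct.mk k H H l).rTensor H (comul (R := k) h) := by
    have h0 : s.twist ∘ₗ TensorProduct.mk k H H l = ∑ i ∈ (ℛ k l).index,
        TensorProduct.map (s.coc ∘ₗ TensorProduct.mk k H H ((ℛ k l).left i))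
          (LinearMap.mulLeft k ((ℛ k l).right i)) ∘ₗ comul := by
      ext y
      simp [s.twist_tmul]
    have h1 (a : H →ₗ[k] A) (b : H) : (TensorProduct.assoc k A H H).symm.toLinearMap ∘ₗ
        TensorProduct.map a ((LinearMap.mulLeft k b).rTensor H) =
        (TensorProduct.map a (LinearMap.mulLeft k b)).rTensor H ∘ₗ
          (TensorProduct.assoc k H H H).symm.toLinearMap := by
      ext x y z
      simp
    have h2 (a b y : H) : (rightConv (toConv (.id : H →ₗ[k] H))).lTensor A
        (s.coc.rTensor (H ⊗[k] H)
          (TensorProduct.AlgebraTensorModule.tensorTensorTensorComm k k k k H H H H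
            ((a ⊗ₜ b) ⊗ₜ comul (R := k) y))) =
        TensorProduct.map (s.coc ∘ₗ TensorProduct.mk k H H a)
          ((LinearMap.mulLeft k b).rTensor H) (comul.lTensor H (comul (R := k) y)) := by
      induction comul (R := k) y with
      | zero => simp
      | add u v hu hv => simp only [TensorProduct.tmul_add, map_add, hu, hv]
      | tmul u v => simp [rightConv_tmul]
    replace h0 := congrArg (LinearMap.rTensorHom H) h0
    rw [map_sum] at h0
    simp only [LinearMap.coe_rTensorHom] at h0
    rw [h0, LinearMap.sum_apply, TensorProduct.comul_tmul]
    conv_lhs => rw [← (ℛ k l).eq]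
    simp only [TensorProduct.sum_tmul, map_sum, h2]
    refine Finset.sum_congr rfl fun i _ => ?_
    rw [LinearMap.rTensor_comp_apply, ← coassoc_symm_apply]
    exact LinearMap.congr_fun (h1 _ _) _
  induction z with
  | zero => simp
  | add u v hu hv => simp only [map_add, hu, hv]
  | tmul a x =>
    induction x with
    | zero => simp
    | add u v hu hv => simp only [TensorProduct.tmul_add, map_add, hu, hv]
    | tmul l h =>
      have h1 (z : A ⊗[k] (H ⊗[k] H)) : Ω.toLinearMap.rTensor H
          ((TensorProduct.assoc k A H H).symm ((rightConv (toConv (.id : H →ₗ[k] H))).lTensor A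
            ((LinearMap.mulLeft k a).rTensor (H ⊗[k] H) z))) =
          (LinearMap.mulLeft k (σ a)).rTensor H (Ω.toLinearMap.rTensor H
            ((TensorProduct.assoc k A H H).symm
              ((rightConv (toConv (.id : H →ₗ[k] H))).lTensor A z))) := by
        induction z with
        | zero => simp
        | add u v hu hv => simp only [map_add, hu, hv]
        | tmul b x =>
          simp only [LinearMap.rTensor_tmul, LinearMap.lTensor_tmul]
          induction rightConv (toConv (.id : H →ₗ[k] H)) x with
          | zero => simp
          | add u v hu hv => simp only [TensorProduct.tmul_add, map_add, hu, hv]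
          | tmul u v => simp [hΩ.apply_tmul, mul_assoc]
      rw [rightConv_tmul, toConv_ofConv, h1, key, TensorProduct.assoc_symm_tmul,
        LinearMap.rTensor_tmul, LinearEquiv.coe_coe, hΩ.apply_tmul, rightConv_tmul,
        LinearMap.mulLeft_mul, LinearMap.rTensor_comp_apply]
      refine congrArg _ ?_
      rw [← LinearMap.rTensor_comp_apply, ← LinearMap.rTensor_comp_apply]
      refine congrArg (fun F : H →ₗ[k] P => F.rTensor H (comul (R := k) h)) ?_
      ext y
      have h2 := congrArg (fun F : WithConv (H ⊗[k] H →ₗ[k] P) => F (l ⊗ₜ y))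
        hΩ.cleaving_mul_cleaving
      simp only [convComap_legFst_mul_legSnd_apply] at h2
      exact h2.trans (apply_twist hΩ.apply_tmul (l ⊗ₜ y)).symm

theorem isCleft_coaction (hΩ : s.IsTrivialization σ Ω) : hΩ.coaction.IsCleft := by
  refine ⟨(cleaving Ω).ofConv, hΩ.isColinear_cleaving, ?_⟩
  rw [toConv_ofConv]
  apply isUnit_of_rightConv_bijective
  have hB : IsUnit (toConv (.id : H →ₗ[k] H)) :=
    ⟨⟨_, toConv (antipode k), LinearMap.id_mul_antipode, LinearMap.antipode_mul_id⟩, rfl⟩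
  let e1 := ((TensorProduct.assoc k A H H).symm.trans (LinearEquiv.rTensor H Ω))
  let e2 := LinearEquiv.lTensor A (LinearEquiv.ofBijective _ (rightConv_bijective hB))
  have h1 : ⇑(rightConv (cleaving Ω)) ∘ e1 = e1 ∘ e2 ∘ rightConv (toConv s.coc) :=
    funext hΩ.rightConv_cleaving
  have h2 : Function.Bijective (⇑(rightConv (cleaving Ω)) ∘ e1) := by
    rw [h1]
    exact e1.bijective.comp (e2.bijective.comp (rightConv_bijective s.isUnit_coc))
  exact (Function.Bijective.of_comp_iff _ e1.bijective).1 h2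

end CrossedSystem.IsTrivialization

/-! ### Trivializing cleft extensions -/

namespace Coaction

open WithConv Coalgebra HopfAlgebra CrossedSystem

variable {k : Type*} [Field k] {H : Type*} [Ring H] [HopfAlgebra k H]
variable {P : Type*} [Ring P] [Algebra k P] (c : Coaction k H P)
variable {A : Type*} [Ring A] [Algebra k A] {σ : A →ₐ[k] P}
variable {γ γ' : WithConv (H →ₗ[k] P)}

/-- The map `a ⊗ h ↦ σ(a) γ(h)` has the inverse `p ↦ p₀ γ⁻¹(p₁) ⊗ p₂`. -/
theorem exists_linearEquiv (hσ : Function.Injective σ) (hr : σ.range = c.coinvariants)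
    (hγ : c.IsColinear γ.ofConv) (h1 : γ * γ' = 1) (h2 : γ' * γ = 1) :
    ∃ Ω : (A ⊗[k] H) ≃ₗ[k] P, ∀ a h, Ω (a ⊗ₜ h) = σ a * γ h := by
  have hmem (p : P) : c.convAct .id γ' p ∈ LinearMap.range σ.toLinearMap := by
    have h := LinearMap.congr_fun (c.comp_convAct c.δ .id γ') p
    rw [LinearMap.comp_id, c.convMap_δ_inverse hγ h1 h2, convAct_mul,
      convAct_δ_convRightAntipode, ← LinearMap.comp_id (incl k H P).toLinearMap,
      ← c.comp_convAct] at h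
    have h' : c.convAct .id γ' p ∈ c.coinvariants := h
    rw [← hr] at h'
    exact h'
  let e := LinearEquiv.ofInjective σ.toLinearMap hσ
  let T : P →ₗ[k] A := e.symm.toLinearMap ∘ₗ (c.convAct .id γ').codRestrict _ hmem
  have hT (p : P) : σ (T p) = c.convAct .id γ' p :=
    congrArg Subtype.val (e.apply_symm_apply ⟨_, hmem p⟩)
  have hTγ (a : A) (h : H) : T.rTensor H (c.δ (σ a * γ h)) = a ⊗ₜ h := by
    have hδ (h : H) : c.δ (σ a * γ h) =
        (LinearMap.mulLeft k (σ a)).rTensor H (γ.ofConv.rTensor H (comul (R := k) h)) := by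
      have ha : c.δ (σ a) = σ a ⊗ₜ 1 := by
        have : σ a ∈ c.coinvariants := hr ▸ ⟨a, rfl⟩
        exact this
      rw [map_mul, hγ, ha, ← (ℛ k h).eq]
      simp [Finset.mul_sum]
    have hTa (h : H) : T (σ a * γ h) = Coalgebra.counit (R := k) h • a := by
      apply hσ
      rw [hT, convAct, LinearMap.comp_apply, LinearMap.comp_apply, AlgHom.toLinearMap_apply, hδ]
      have h3 := congrArg (fun F : WithConv (H →ₗ[k] P) => σ a * F h) h1
      simp only [(ℛ k h).convMul_apply] at h3
      rw [← (ℛ k h).eq]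
      simp only [map_sum, LinearMap.rTensor_tmul, TensorProduct.map_tmul, LinearMap.mul'_apply,
        LinearMap.mulLeft_apply, LinearMap.id_apply, mul_assoc, ← Finset.mul_sum]
      refine h3.trans ?_
      simp [Algebra.algebraMap_eq_smul_one]
    rw [hδ, ← (ℛ k h).eq]
    simp only [map_sum, LinearMap.rTensor_tmul, LinearMap.mulLeft_apply, hTa]
    simp only [TensorProduct.smul_tmul]
    rw [← TensorProduct.tmul_sum, sum_counit_smul]
  let Φ : A ⊗[k] H →ₗ[k] P := LinearMap.mul' k P ∘ₗ TensorProduct.map σ.toLinearMap γ.ofConv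
  let Ψ : P →ₗ[k] A ⊗[k] H := T.rTensor H ∘ₗ c.δ.toLinearMap
  have hΦΨ : Φ ∘ₗ Ψ = .id := by
    have h3 : σ.toLinearMap ∘ₗ T = c.convAct .id γ' := LinearMap.ext hT
    have h4 : Φ ∘ₗ Ψ = c.convAct (σ.toLinearMap ∘ₗ T) γ := by
      refine LinearMap.ext fun p => congrArg (LinearMap.mul' k P) ?_
      exact LinearMap.congr_fun (LinearMap.map_comp_rTensor _ _ _ _) (c.δ p)
    rw [h4, h3, ← convAct_mul, h2, convAct_one]
  have hΨΦ : Ψ ∘ₗ Φ = .id := by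
    refine TensorProduct.ext' fun a h => ?_
    exact hTγ a h
  exact ⟨LinearEquiv.ofLinearMap Φ Ψ hΦΨ hΨΦ, fun a h => rfl⟩

/-- The crossed system given by a normalized cleaving map trivializes the extension. -/
theorem exists_isTrivialization (hσ : Function.Injective σ) (hr : σ.range = c.coinvariants)
    (hγ : c.IsTotalIntegral γ.ofConv) (h1 : γ * γ' = 1) (h2 : γ' * γ = 1) :
    ∃ (s : CrossedSystem k H A) (Ω : (A ⊗[k] H) ≃ₗ[k] P), s.IsTrivialization σ Ω ∧
      (∀ a, convMap H σ (toConv (s.act.flip a)) = γ * convConst k H (σ a) * γ') ∧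
      convMap (H ⊗[k] H) σ (toConv s.coc) = convComap P (legFst k H H) γ *
        convComap P (legSnd k H H) γ * convComap P (mulHom k H) γ' ∧
      (∀ a h, Ω (a ⊗ₜ h) = σ a * γ h) ∧
      ∀ x, c.δ (Ω x) = Ω.toLinearMap.rTensor H (freeCoaction k H A x) := by
  obtain ⟨s, hact, hcoc⟩ := c.exists_crossedSystem hσ hr hγ h1 h2
  obtain ⟨Ω, hΩ⟩ := c.exists_linearEquiv hσ hr hγ.colinear h1 h2
  have hγ1 : γ 1 = 1 := hγ.map_one
  refine ⟨s, Ω, ⟨fun x y => ?_, fun a => by rw [hΩ, hγ1, mul_one]⟩, hact, hcoc, hΩ, fun x => ?_⟩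
  · induction x with
    | zero => simp
    | add x x' hx hx' => simp only [TensorProduct.add_tmul, map_add, hx, hx', add_mul]
    | tmul a h =>
      induction y with
      | zero => simp
      | add y y' hy hy' => simp only [TensorProduct.tmul_add, map_add, hy, hy', mul_add]
      | tmul b l =>
        have e := convComap_mul_cancel h2 (mulHom k H) (1 : WithConv (H ⊗[k] H →ₗ[k] P))
        have e' := convComap_mul_cancel h2 (legFst k H H) (convComap P (legSnd k H H) γ)
        rw [mul_one] at e
        rw [apply_mul_tmul hΩ, hact, hcoc, hΩ, hΩ, mul_assoc _ _ (convComap P (mulHom k H) γ),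
          ← map_mul (convComap P (mulHom k H)), h2, map_one, mul_one, map_mul,
          mul_assoc _ _ (_ * _), e', convComap_legFst_mul_legSnd_apply, mul_convConst_apply]
        simp only [mul_assoc]
  · induction x with
    | zero => simp
    | add x y hx hy => simp only [map_add, hx, hy]
    | tmul a h =>
      have ha : c.δ (σ a) = σ a ⊗ₜ 1 := by
        have : σ a ∈ c.coinvariants := hr ▸ ⟨a, rfl⟩
        exact this
      rw [hΩ, map_mul, hγ.colinear, ha]
      simp only [freeCoaction, LinearMap.comp_apply, LinearMap.lTensor_tmul, LinearEquiv.coe_coe]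
      rw [← (ℛ k h).eq]
      simp [Finset.mul_sum, TensorProduct.tmul_sum, hΩ]

end Coaction

/-! ### Gluing sections of a sheaf tensored with a vector space -/

section Gluing

variable {k : Type v} [Field k] {X : TopCat.{u}} (F : X.Sheaf (AlgCat.{u} k))

@[simp] theorem res_self {V : Opens X} (h : V ≤ V) (p : Sec F V) : res F h p = p := by
  simp [res]

theorem res_res {V₁ V₂ V₃ : Opens X} (h : V₂ ≤ V₁) (h' : V₃ ≤ V₂) (p : Sec F V₁) :
    res F h' (res F h p) = res F (h'.trans h) p := by
  have h1 : (homOfLE (h'.trans h)).op = (homOfLE h).op ≫ (homOfLE h').op := rfl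
  simp [res, h1]

theorem res_comp_res {V₁ V₂ V₃ : Opens X} (h : V₂ ≤ V₁) (h' : V₃ ≤ V₂) :
    (res F h').toLinearMap ∘ₗ (res F h).toLinearMap = (res F (h'.trans h)).toLinearMap :=
  LinearMap.ext (res_res F h h')

theorem onSec_res {F G : X.Sheaf (AlgCat.{u} k)} (f : F ⟶ G) {V W : Opens X} (h : W ≤ V)
    (p : Sec F V) : onSec f W (res F h p) = res G h (onSec f V p) :=
  ConcreteCategory.congr_hom (f.1.naturality (homOfLE h).op) p

variable {F} {ι : Type*} {U : ι → Opens X} {V : Opens X}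

theorem sec_ext (hU : ∀ i, U i ≤ V) (hV : V ≤ iSup U) {p q : Sec F V}
    (h : ∀ i, res F (hU i) p = res F (hU i) q) : p = q :=
  F.eq_of_locally_eq' U V (fun i => homOfLE (hU i)) hV p q h

theorem exists_res_eq (hU : ∀ i, U i ≤ V) (hV : V ≤ iSup U) (p : ∀ i, Sec F (U i))
    (h : ∀ i j, res F (inf_le_left : U i ⊓ U j ≤ U i) (p i) =
      res F (inf_le_right : U i ⊓ U j ≤ U j) (p j)) :
    ∃ q : Sec F V, ∀ i, res F (hU i) q = p i :=
  (F.existsUnique_gluing' U V (fun i => homOfLE (hU i)) hV p h).exists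

variable {W : Type*} [AddCommGroup W] [Module k W]

theorem equivFinsuppOfBasisRight_rTensor {M N κ : Type*} [AddCommGroup M] [Module k M]
    [AddCommGroup N] [Module k N] [DecidableEq κ] (b : Module.Basis κ k W) (θ : M →ₗ[k] N)
    (z : M ⊗[k] W) (j : κ) :
    TensorProduct.equivFinsuppOfBasisRight b (θ.rTensor W z) j =
      θ (TensorProduct.equivFinsuppOfBasisRight b z j) := by
  rw [TensorProduct.equivFinsuppOfBasisRight_apply, TensorProduct.equivFinsuppOfBasisRight_apply]
  induction z with
  | zero => simp
  | add x y hx hy => simp only [map_add, hx, hy]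
  | tmul x y => simp

/-- The presheaf `V ↦ F(V) ⊗ W` is separated. -/
theorem tensor_ext (hU : ∀ i, U i ≤ V) (hV : V ≤ iSup U) {x y : Sec F V ⊗[k] W}
    (h : ∀ i, (res F (hU i)).toLinearMap.rTensor W x = (res F (hU i)).toLinearMap.rTensor W y) :
    x = y := by
  classical
  let b := Module.Basis.ofVectorSpace k W
  apply (TensorProduct.equivFinsuppOfBasisRight (M := Sec F V) b).injective
  ext j
  refine sec_ext hU hV fun i => ?_
  have h1 := congrArg (fun z => TensorProduct.equivFinsuppOfBasisRight b z j) (h i)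
  simp only [equivFinsuppOfBasisRight_rTensor] at h1
  exact h1

/-- For finite coverings, compatible elements of the `F(U i) ⊗ W` glue: only finitely many basis
vectors of `W` are involved, and the coefficients glue. -/
theorem exists_tensor_eq [Finite ι] (hU : ∀ i, U i ≤ V) (hV : V ≤ iSup U)
    (x : ∀ i, Sec F (U i) ⊗[k] W)
    (h : ∀ i j, (res F (inf_le_left : U i ⊓ U j ≤ U i)).toLinearMap.rTensor W (x i) =
      (res F (inf_le_right : U i ⊓ U j ≤ U j)).toLinearMap.rTensor W (x j)) :
    ∃ y : Sec F V ⊗[k] W, ∀ i, (res F (hU i)).toLinearMap.rTensor W y = x i := by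
  classical
  cases nonempty_fintype ι
  let b := Module.Basis.ofVectorSpace k W
  let e (V : Opens X) := TensorProduct.equivFinsuppOfBasisRight (M := Sec F V) b
  have hglue (l) : ∃ q : Sec F V, ∀ i, res F (hU i) q = e (U i) (x i) l := by
    refine exists_res_eq hU hV _ fun i j => ?_
    have h1 := congrArg (fun z => TensorProduct.equivFinsuppOfBasisRight b z l) (h i j)
    simp only [equivFinsuppOfBasisRight_rTensor] at h1
    exact h1
  choose q hq using hglue
  let y : _ →₀ Sec F V := Finsupp.onFinset (Finset.univ.biUnion fun i => (e (U i) (x i)).support) q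
    fun l hl => by
      by_contra hl'
      refine hl (sec_ext hU hV fun i => ?_)
      rw [hq, map_zero]
      by_contra h0
      exact hl' (Finset.mem_biUnion.2 ⟨i, Finset.mem_univ i, Finsupp.mem_support_iff.2 h0⟩)
  refine ⟨(e V).symm y, fun i => (e (U i)).injective ?_⟩
  ext l
  change TensorProduct.equivFinsuppOfBasisRight b _ l = _
  rw [equivFinsuppOfBasisRight_rTensor]
  refine (congrArg (fun z : _ →₀ Sec F V => res F (hU i) (z l))
    ((e V).apply_symm_apply y)).trans ?_
  exact hq l i

end Gluing

/-! ### Gluing coactions -/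

section GluingCoactions

open Coalgebra

theorem rTensor_algHom_mul {k A B H : Type*} [Field k] [Ring A] [Algebra k A] [Ring B] [Algebra k B]
    [Ring H] [Algebra k H] (θ : A →ₐ[k] B) (x y : A ⊗[k] H) :
    θ.toLinearMap.rTensor H (x * y) = θ.toLinearMap.rTensor H x * θ.toLinearMap.rTensor H y :=
  map_mul (Algebra.TensorProduct.map θ (AlgHom.id k H)) x y

theorem rTensor_algHom_one {k A B H : Type*} [Field k] [Ring A] [Algebra k A] [Ring B] [Algebra k B]
    [Ring H] [Algebra k H] (θ : A →ₐ[k] B) : θ.toLinearMap.rTensor H (1 : A ⊗[k] H) = 1 :=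
  map_one (Algebra.TensorProduct.map θ (AlgHom.id k H))

variable {k : Type v} [Field k] {X : TopCat.{u}} {F : X.Sheaf (AlgCat.{u} k)}
variable {H : Type w} [Ring H] [HopfAlgebra k H]

theorem rTensor_res_self {W : Type*} [AddCommGroup W] [Module k W] {V : Opens X} (h : V ≤ V)
    (x : Sec F V ⊗[k] W) : (res F h).toLinearMap.rTensor W x = x := by
  have h1 : (res F h).toLinearMap = .id := LinearMap.ext fun p => res_self F h p
  rw [h1, LinearMap.rTensor_id, LinearMap.id_apply]

theorem rTensor_res_res {W : Type*} [AddCommGroup W] [Module k W] {V₁ V₂ V₃ : Opens X}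
    (h : V₂ ≤ V₁) (h' : V₃ ≤ V₂) (x : Sec F V₁ ⊗[k] W) :
    (res F h').toLinearMap.rTensor W ((res F h).toLinearMap.rTensor W x) =
      (res F (h'.trans h)).toLinearMap.rTensor W x := by
  rw [← LinearMap.rTensor_comp_apply, res_comp_res]

/-- Coactions on the sections over all `V ⊆ U i` that are compatible with restrictions and do not
depend on `i` come from a coaction on the sheaf if finitely many of the `U i` cover `X`. -/
theorem exists_sheafCoaction {ι : Type*} {U : ι → Opens X}
    (hfin : ∃ s : Finset ι, ⨆ i ∈ s, U i = ⊤)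
    (c : ∀ (i : ι) (V : Opens X), V ≤ U i → Coaction k H (Sec F V))
    (hres : ∀ (i : ι) ⦃V W : Opens X⦄ (hV : V ≤ U i) (hWV : W ≤ V) (p : Sec F V),
      (c i W (hWV.trans hV)).δ (res F hWV p) =
        (res F hWV).toLinearMap.rTensor H ((c i V hV).δ p))
    (hij : ∀ (i j : ι) (V : Opens X) (hi : V ≤ U i) (hj : V ≤ U j) (p : Sec F V),
      (c i V hi).δ p = (c j V hj).δ p) :
    ∃ c' : SheafCoaction H F, ∀ (i : ι) (V : Opens X) (hV : V ≤ U i) (p : Sec F V),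
      (c'.on V).δ p = (c i V hV).δ p := by
  obtain ⟨s, hs⟩ := hfin
  have hcover (V : Opens X) : V ≤ ⨆ j : s, V ⊓ U j := by
    rw [← inf_iSup_eq, iSup_subtype]
    exact le_inf le_rfl (le_top.trans hs.ge)
  have hex (V : Opens X) (p : Sec F V) : ∃ y : Sec F V ⊗[k] H, ∀ j : s,
      (res F (inf_le_left : V ⊓ U j ≤ V)).toLinearMap.rTensor H y =
        (c j (V ⊓ U j) inf_le_right).δ (res F inf_le_left p) := by
    refine exists_tensor_eq (fun j : s => inf_le_left) (hcover V) _ fun i j => ?_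
    rw [← hres, ← hres, res_res, res_res]
    exact hij _ _ _ _ _ _
  choose D hD using hex
  have hDi (i : ι) {V W : Opens X} (hWV : W ≤ V) (hW : W ≤ U i) (p : Sec F V) :
      (res F hWV).toLinearMap.rTensor H (D V p) = (c i W hW).δ (res F hWV p) := by
    refine tensor_ext (fun j : s => inf_le_left) (hcover W) fun j => ?_
    have h1 := congrArg ((res F (inf_le_inf_right (U j) hWV)).toLinearMap.rTensor H) (hD V p j)
    rw [rTensor_res_res, ← hres, res_res] at h1
    rw [rTensor_res_res, ← hres, res_res]
    exact h1.trans (hij _ _ _ _ _ _)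
  -- by this, identities between elements of `F(V) ⊗ Z` are checked where local coactions exist
  have hloc {V : Opens X} {Z : Type _} [AddCommGroup Z] [Module k Z] {x y : Sec F V ⊗[k] Z}
      (h : ∀ (i : ι) (W : Opens X) (hW : W ≤ V), W ≤ U i →
        (res F hW).toLinearMap.rTensor Z x = (res F hW).toLinearMap.rTensor Z y) : x = y :=
    tensor_ext (fun j : s => inf_le_left) (hcover V) fun j => h j _ _ inf_le_right
  have hD1 (V : Opens X) : D V 1 = 1 := hloc fun i W hWV hW => by
    rw [hDi i hWV hW, map_one, map_one, rTensor_algHom_one]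
  have hDmul (V : Opens X) (p q : Sec F V) : D V (p * q) = D V p * D V q :=
    hloc fun i W hWV hW => by
      rw [rTensor_algHom_mul, hDi i hWV hW, hDi i hWV hW, hDi i hWV hW, map_mul, map_mul]
  let δ (V : Opens X) : Sec F V →ₐ[k] Sec F V ⊗[k] H := AlgHom.ofLinearMap
    { toFun := D V
      map_add' := fun p q => hloc fun i W hWV hW => by
        rw [map_add, hDi i hWV hW, hDi i hWV hW, hDi i hWV hW, map_add, map_add]
      map_smul' := fun r p => hloc fun i W hWV hW => by
        rw [RingHom.id_apply, map_smul, hDi i hWV hW, hDi i hWV hW, map_smul, map_smul] }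
    (hD1 V) (hDmul V)
  have hδ (i : ι) {V W : Opens X} (hWV : W ≤ V) (hW : W ≤ U i) (p : Sec F V) :
      (res F hWV).toLinearMap.rTensor H (δ V p) = (c i W hW).δ (res F hWV p) := hDi i hWV hW p
  refine ⟨⟨fun V => ⟨δ V, fun p => ?_, fun p => ?_⟩, fun V W hWV p => ?_⟩, fun i V hV p => ?_⟩
  · refine hloc fun i W hWV hW => ?_
    have h1 : (res F hWV).toLinearMap.rTensor H ∘ₗ (δ V).toLinearMap =
        (c i W hW).δ.toLinearMap ∘ₗ (res F hWV).toLinearMap := LinearMap.ext (hδ i hWV hW)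
    have h2 : (res F hWV).toLinearMap.rTensor (H ⊗[k] H) ∘ₗ
        (TensorProduct.assoc k (Sec F V) H H).toLinearMap =
        (TensorProduct.assoc k (Sec F W) H H).toLinearMap ∘ₗ
          ((res F hWV).toLinearMap.rTensor H).rTensor H := by
      ext x y z
      simp
    refine (LinearMap.congr_fun h2 _).trans ?_
    rw [LinearMap.comp_apply, ← LinearMap.rTensor_comp_apply, h1, LinearMap.rTensor_comp_apply,
      hδ i hWV hW, LinearEquiv.coe_coe, (c i W hW).coassoc, ← hδ i hWV hW,
      ← LinearMap.comp_apply, ← LinearMap.comp_apply, LinearMap.rTensor_comp_lTensor,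
      LinearMap.lTensor_comp_rTensor]
  · refine sec_ext (fun j : s => inf_le_left) (hcover V) fun j => ?_
    have h1 : (res F (inf_le_left : V ⊓ U j ≤ V)).toLinearMap ∘ₗ
        (TensorProduct.rid k (Sec F V)).toLinearMap ∘ₗ (counit (R := k) (A := H)).lTensor _ =
        (TensorProduct.rid k _).toLinearMap ∘ₗ (counit (R := k) (A := H)).lTensor _ ∘ₗ
          (res F (inf_le_left : V ⊓ U j ≤ V)).toLinearMap.rTensor H := by
      ext x y
      simp
    refine (LinearMap.congr_fun h1 (δ V p)).trans ?_
    rw [LinearMap.comp_apply, LinearMap.comp_apply, hδ j inf_le_left inf_le_right,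
      LinearEquiv.coe_coe, (c j _ _).counit]
  · refine hloc fun i W' hW' hU => ?_
    rw [hδ i _ hU, rTensor_res_res]
    exact ((hδ i _ hU p).trans (by rw [res_res])).symm
  · have h1 := hδ i le_rfl hV p
    rwa [rTensor_res_self, res_self] at h1

end GluingCoactions

/-! ### Patching total integrals and canonical maps -/

namespace Coaction

open WithConv Coalgebra HopfAlgebra

variable {k : Type*} [Field k] {H : Type*} [Ring H] [HopfAlgebra k H]
variable {P Q : Type*} [Ring P] [Algebra k P] [Ring Q] [Algebra k Q]
  {c : Coaction k H P} {d : Coaction k H Q} {θ : P →ₐ[k] Q}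

variable (c d θ) in
/-- `θ` is a morphism of `H`-comodule algebras. -/
def IsComoduleHom : Prop := ∀ p, d.δ (θ p) = θ.toLinearMap.rTensor H (c.δ p)

theorem IsComoduleHom.convAct (hθ : IsComoduleHom c d θ) (f : WithConv (H →ₗ[k] Q)) (p : P) :
    d.convAct .id f (θ p) = c.convAct θ.toLinearMap f p := by
  have h : TensorProduct.map .id f.ofConv ∘ₗ θ.toLinearMap.rTensor H =
      TensorProduct.map θ.toLinearMap f.ofConv := by
    rw [LinearMap.map_comp_rTensor, LinearMap.id_comp]
  simp only [Coaction.convAct, LinearMap.comp_apply, AlgHom.toLinearMap_apply, hθ p, ← h]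

theorem IsComoduleHom.retraction (hθ : IsComoduleHom c d θ) (j : H →ₗ[k] P) (z : P ⊗[k] H) :
    θ (c.retraction j z) =
      d.retraction (θ.toLinearMap ∘ₗ j) (θ.toLinearMap.rTensor H z) := by
  induction z with
  | zero => simp
  | add x y hx hy => simp only [map_add, hx, hy]
  | tmul p g =>
    rw [LinearMap.rTensor_tmul, retraction_tmul, retraction_tmul, AlgHom.toLinearMap_apply,
      hθ.convAct]
    exact LinearMap.congr_fun (c.comp_convAct θ .id _) p

theorem IsComoduleHom.isColinear (hθ : IsComoduleHom c d θ) {j : H →ₗ[k] P}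
    (hj : c.IsColinear j) : d.IsColinear (θ.toLinearMap ∘ₗ j) := by
  intro h
  rw [LinearMap.comp_apply, AlgHom.toLinearMap_apply, hθ, hj, LinearMap.rTensor_comp_apply]

theorem IsColinear.add {f g : H →ₗ[k] P} (hf : c.IsColinear f) (hg : c.IsColinear g) :
    c.IsColinear (f + g) := by
  intro h
  rw [LinearMap.add_apply, map_add, hf, hg, LinearMap.rTensor_add, LinearMap.add_apply]

theorem IsColinear.sub {f g : H →ₗ[k] P} (hf : c.IsColinear f) (hg : c.IsColinear g) :
    c.IsColinear (f - g) := by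
  intro h
  rw [LinearMap.sub_apply, map_sub, hf, hg, LinearMap.rTensor_sub, LinearMap.sub_apply]

theorem freeCoaction_rTensor (φ : Q →ₗ[k] P) (z : Q ⊗[k] H) :
    freeCoaction k H P (φ.rTensor H z) = (φ.rTensor H).rTensor H (freeCoaction k H Q z) := by
  have h : (TensorProduct.assoc k P H H).symm.toLinearMap ∘ₗ φ.rTensor (H ⊗[k] H) =
      (φ.rTensor H).rTensor H ∘ₗ (TensorProduct.assoc k Q H H).symm.toLinearMap := by
    ext x y z
    simp
  have h' : (comul (R := k) (A := H)).lTensor P (φ.rTensor H z) =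
      φ.rTensor (H ⊗[k] H) (comul.lTensor Q z) := by
    rw [← LinearMap.comp_apply, LinearMap.lTensor_comp_rTensor, ← LinearMap.rTensor_comp_lTensor]
    rfl
  exact (congrArg (TensorProduct.assoc k P H H).symm h').trans (LinearMap.congr_fun h _)

theorem freeCoaction_δ (c : Coaction k H P) (p : P) :
    freeCoaction k H P (c.δ p) = c.δ.toLinearMap.rTensor H (c.δ p) := by
  rw [freeCoaction, LinearMap.comp_apply, ← c.coassoc]
  exact LinearEquiv.symm_apply_apply _ _

/-- A total integral on `P` makes `P ⊗ H` retract onto `P` colinearly, so colinear maps lift along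
surjective morphisms `P → Q`: lift linearly, extend to `P ⊗ H`, and retract. -/
theorem IsComoduleHom.exists_colinear_lift (hθ : IsComoduleHom c d θ)
    (hs : Function.Surjective θ) {j : H →ₗ[k] P} (hj : c.IsTotalIntegral j) {f : H →ₗ[k] Q}
    (hf : d.IsColinear f) :
    ∃ α : H →ₗ[k] P, c.IsColinear α ∧ θ.toLinearMap ∘ₗ α = f ∧ (f 1 = 0 → α 1 = 0) := by
  obtain ⟨s, hs⟩ := θ.toLinearMap.exists_rightInverse_of_surjective (LinearMap.range_eq_top.2 hs)
  let β : Q →ₗ[k] P := c.retraction j ∘ₗ s.rTensor H ∘ₗ d.δ.toLinearMap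
  refine ⟨β ∘ₗ f, fun h => ?_, ?_, fun h => by rw [LinearMap.comp_apply, h, map_zero]⟩
  · have h1 : freeCoaction k H P (s.rTensor H (d.δ (f h))) =
        (s.rTensor H).rTensor H (d.δ.toLinearMap.rTensor H (f.rTensor H (comul (R := k) h))) := by
      rw [freeCoaction_rTensor, freeCoaction_δ, hf]
    refine (c.δ_retraction hj.colinear _).trans ?_
    change (c.retraction j).rTensor H (freeCoaction k H P (s.rTensor H (d.δ (f h)))) = _
    rw [h1]
    simp only [β, ← LinearMap.rTensor_comp_apply, LinearMap.comp_assoc]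
  · ext h
    refine (hθ.retraction j _).trans ?_
    rw [LinearMap.comp_apply, ← LinearMap.rTensor_comp_apply, hs, LinearMap.rTensor_id,
      LinearMap.id_apply]
    refine d.retraction_δ ?_ _
    rw [LinearMap.comp_apply, hj.map_one, AlgHom.toLinearMap_apply, map_one]

theorem IsComoduleHom.canLift (hθ : IsComoduleHom c d θ) (z : P ⊗[k] P) :
    d.canLift (TensorProduct.map θ.toLinearMap θ.toLinearMap z) =
      θ.toLinearMap.rTensor H (c.canLift z) := by
  induction z with
  | zero => simp
  | add x y hx hy => simp only [map_add, hx, hy]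
  | tmul p q =>
    rw [TensorProduct.map_tmul, canLift_tmul, canLift_tmul, rTensor_algHom_mul,
      AlgHom.toLinearMap_apply, AlgHom.toLinearMap_apply, hθ]
    simp

/-- The condition that is patched from the members of a covering to their union: the existence of
a total integral and the surjectivity of the canonical map. -/
def IsPatchable (c : Coaction k H P) : Prop :=
  (∃ j, c.IsTotalIntegral j) ∧ Function.Surjective c.canLift

theorem IsCleft.isPatchable (hc : c.IsCleft) : c.IsPatchable := by
  obtain ⟨γ, hγ, hu⟩ := hc.exists_isTotalIntegral
  exact ⟨⟨γ, hγ⟩, c.canLift_surjective_of_isColinear hγ.colinear hu⟩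

variable {P₁ P₂ : Type*} [Ring P₁] [Algebra k P₁] [Ring P₂] [Algebra k P₂]
  {c₁ : Coaction k H P₁} {c₂ : Coaction k H P₂}
  {r₁ : P →ₐ[k] P₁} {r₂ : P →ₐ[k] P₂} {q₁ : P₁ →ₐ[k] Q} {q₂ : P₂ →ₐ[k] Q}

/-- Total integrals `j₁`, `j₂` on `P₁`, `P₂` glue on the pullback `P` once `j₁` is corrected by a
colinear lift along `q₁ : P₁ → Q` of the difference `q₂ ∘ j₂ - q₁ ∘ j₁`. -/
theorem IsTotalIntegral.exists_of_pullback (hr₁ : IsComoduleHom c c₁ r₁)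
    (hr₂ : IsComoduleHom c c₂ r₂) (hq₁ : IsComoduleHom c₁ d q₁) (hq₂ : IsComoduleHom c₂ d q₂)
    (hsurj : Function.Surjective q₁)
    (hex : ∀ x₁ x₂, q₁ x₁ = q₂ x₂ → ∃ p, r₁ p = x₁ ∧ r₂ p = x₂)
    (hinj : ∀ x y : P, r₁ x = r₁ y → r₂ x = r₂ y → x = y)
    (hinjH : ∀ x y : P ⊗[k] H, r₁.toLinearMap.rTensor H x = r₁.toLinearMap.rTensor H y →
      r₂.toLinearMap.rTensor H x = r₂.toLinearMap.rTensor H y → x = y)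
    {j₁ : H →ₗ[k] P₁} (hj₁ : c₁.IsTotalIntegral j₁) {j₂ : H →ₗ[k] P₂}
    (hj₂ : c₂.IsTotalIntegral j₂) : ∃ j, c.IsTotalIntegral j := by
  obtain ⟨α, hα, hα', hα1⟩ := hq₁.exists_colinear_lift hsurj hj₁
    ((hq₂.isColinear hj₂.colinear).sub (hq₁.isColinear hj₁.colinear))
  have hj (h : H) : q₁ ((j₁ + α) h) = q₂ (j₂ h) := by
    have h1 := LinearMap.congr_fun hα' h
    simp only [LinearMap.comp_apply, AlgHom.toLinearMap_apply, LinearMap.sub_apply] at h1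
    rw [LinearMap.add_apply, map_add, h1, add_sub_cancel]
  choose j hjr₁ hjr₂ using fun h => hex _ _ (hj h)
  let J : H →ₗ[k] P :=
    { toFun := j
      map_add' := fun x y => hinj _ _ (by rw [map_add, hjr₁, hjr₁, hjr₁, map_add])
        (by rw [map_add, hjr₂, hjr₂, hjr₂, map_add])
      map_smul' := fun r x => hinj _ _ (by rw [RingHom.id_apply, map_smul, hjr₁, hjr₁, map_smul])
        (by rw [RingHom.id_apply, map_smul, hjr₂, hjr₂, map_smul]) }
  have hJ₁ : r₁.toLinearMap ∘ₗ J = j₁ + α := LinearMap.ext hjr₁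
  have hJ₂ : r₂.toLinearMap ∘ₗ J = j₂ := LinearMap.ext hjr₂
  have hα1' : α 1 = 0 := hα1 (by
    rw [LinearMap.sub_apply, LinearMap.comp_apply, LinearMap.comp_apply, hj₁.map_one, hj₂.map_one,
      AlgHom.toLinearMap_apply, AlgHom.toLinearMap_apply, _root_.map_one, _root_.map_one, sub_self])
  refine ⟨J, fun h => hinjH _ _ ?_ ?_, hinj _ _ ?_ ?_⟩
  · rw [← hr₁, ← LinearMap.rTensor_comp_apply, hJ₁, ← (hj₁.colinear.add hα) h]
    exact congrArg c₁.δ (hjr₁ h)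
  · rw [← hr₂, ← LinearMap.rTensor_comp_apply, hJ₂, ← hj₂.colinear h]
    exact congrArg c₂.δ (hjr₂ h)
  · rw [_root_.map_one r₁]
    exact (hjr₁ 1).trans (by rw [LinearMap.add_apply, hj₁.map_one, hα1', add_zero])
  · rw [_root_.map_one r₂]
    exact (hjr₂ 1).trans hj₂.map_one

/-- A preimage of `1 ⊗ h` over `P₂` is lifted to `P`; the error lies in `ker r₂ ⊗ H`, whose
elements are attained because `P → P₁ × P₂` is injective. -/
theorem canLift_surjective_of_pullback (hr₁ : IsComoduleHom c c₁ r₁)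
    (hr₂ : IsComoduleHom c c₂ r₂)
    (hs₁ : Function.Surjective r₁) (hs₂ : Function.Surjective r₂)
    (hinjH : ∀ x y : P ⊗[k] H, r₁.toLinearMap.rTensor H x = r₁.toLinearMap.rTensor H y →
      r₂.toLinearMap.rTensor H x = r₂.toLinearMap.rTensor H y → x = y)
    (hc₁ : Function.Surjective c₁.canLift) (hc₂ : Function.Surjective c₂.canLift) :
    Function.Surjective c.canLift := by
  have hlift₁ (h : H) : ∃ z, r₁.toLinearMap.rTensor H (c.canLift z) = 1 ⊗ₜ h := by
    obtain ⟨z₁, hz₁⟩ := hc₁ (1 ⊗ₜ h)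
    obtain ⟨z, rfl⟩ := TensorProduct.map_surjective (g := r₁.toLinearMap)
      (g' := r₁.toLinearMap) hs₁ hs₁ z₁
    exact ⟨z, by rw [← hr₁.canLift, hz₁]⟩
  have hlift₂ (h : H) : ∃ z, r₂.toLinearMap.rTensor H (c.canLift z) = 1 ⊗ₜ h := by
    obtain ⟨z₂, hz₂⟩ := hc₂ (1 ⊗ₜ h)
    obtain ⟨z, rfl⟩ := TensorProduct.map_surjective (g := r₂.toLinearMap)
      (g' := r₂.toLinearMap) hs₂ hs₂ z₂
    exact ⟨z, by rw [← hr₂.canLift, hz₂]⟩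
  -- elements supported off the second piece are attained, as `r₁` separates them
  have hker (p : P) (hp : r₂ p = 0) (h : H) : ∃ z, c.canLift z = p ⊗ₜ h := by
    obtain ⟨z, hz⟩ := hlift₁ h
    refine ⟨(p ⊗ₜ 1) * z, hinjH _ _ ?_ ?_⟩
    · rw [canLift_mul, rTensor_algHom_mul, hz]
      simp
    · rw [canLift_mul, rTensor_algHom_mul]
      simp [hp]
  refine c.canLift_surjective fun h => ?_
  obtain ⟨z, hz⟩ := hlift₂ h
  have h0 : r₂.toLinearMap.rTensor H (1 ⊗ₜ h - c.canLift z) = 0 := by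
    rw [map_sub, hz]
    simp
  have hex := rTensor_exact H (LinearMap.exact_subtype_ker_map r₂.toLinearMap) hs₂
  obtain ⟨w, hw⟩ := (hex _).1 h0
  have hw' : ∃ z', c.canLift z' =
      (Submodule.subtype (LinearMap.ker r₂.toLinearMap)).rTensor H w := by
    clear hw
    induction w with
    | zero => exact ⟨0, by simp⟩
    | add x y hx hy =>
      obtain ⟨a, ha⟩ := hx
      obtain ⟨b, hb⟩ := hy
      exact ⟨a + b, by rw [map_add, map_add, ha, hb]⟩
    | tmul p g => exact hker p p.2 g
  obtain ⟨z', hz'⟩ := hw'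
  exact ⟨z' + z, by rw [map_add, hz', hw, sub_add_cancel]⟩

end Coaction

/-! ### Local cleftness implies the Hopf–Galois property on flabby sheaves -/

section Flabby

variable {k : Type v} [Field k] {X : TopCat.{u}} {F : X.Sheaf (AlgCat.{u} k)}
variable {H : Type w} [Ring H] [HopfAlgebra k H]

namespace SheafCoaction

variable (c : SheafCoaction H F)

theorem isComoduleHom_res {V W : Opens X} (h : W ≤ V) :
    Coaction.IsComoduleHom (c.on V) (c.on W) (res F h) := c.res_δ h

theorem isPatchable_bot : (c.on ⊥).IsPatchable := by
  -- `⊥` has the empty covering, so `F(⊥) = 0`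
  have h1 : Subsingleton (Sec F ⊥) :=
    ⟨fun p q => sec_ext (ι := Empty) (U := fun _ => ⊥) (fun i => i.elim) bot_le fun i => i.elim⟩
  have h2 : Subsingleton (Sec F ⊥ ⊗[k] H) :=
    ⟨fun p q => tensor_ext (ι := Empty) (U := fun _ => ⊥) (fun i => i.elim) bot_le
      fun i => i.elim⟩
  exact ⟨⟨0, fun h => Subsingleton.elim _ _, Subsingleton.elim _ _⟩,
    fun x => ⟨0, Subsingleton.elim _ _⟩⟩

theorem isPatchable_sup (hF : IsFlabby F) {V₁ V₂ : Opens X} (h₁ : (c.on V₁).IsPatchable)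
    (h₂ : (c.on V₂).IsPatchable) : (c.on (V₁ ⊔ V₂)).IsPatchable := by
  obtain ⟨⟨j₁, hj₁⟩, hc₁⟩ := h₁
  obtain ⟨⟨j₂, hj₂⟩, hc₂⟩ := h₂
  let U : Bool → Opens X := fun b => cond b V₁ V₂
  have hU : ∀ b, U b ≤ V₁ ⊔ V₂ := Bool.rec le_sup_right le_sup_left
  have hV : V₁ ⊔ V₂ ≤ iSup U := sup_le (le_iSup U true) (le_iSup U false)
  have hinj (x y : Sec F (V₁ ⊔ V₂))
      (e₁ : res F (le_sup_left : V₁ ≤ V₁ ⊔ V₂) x = res F le_sup_left y)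
      (e₂ : res F (le_sup_right : V₂ ≤ V₁ ⊔ V₂) x = res F le_sup_right y) : x = y :=
    sec_ext hU hV (Bool.rec e₂ e₁)
  have hinjH (x y : Sec F (V₁ ⊔ V₂) ⊗[k] H)
      (e₁ : (res F (le_sup_left : V₁ ≤ V₁ ⊔ V₂)).toLinearMap.rTensor H x =
        (res F le_sup_left).toLinearMap.rTensor H y)
      (e₂ : (res F (le_sup_right : V₂ ≤ V₁ ⊔ V₂)).toLinearMap.rTensor H x =
        (res F le_sup_right).toLinearMap.rTensor H y) : x = y :=
    tensor_ext hU hV (Bool.rec e₂ e₁)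
  have hex (x₁ : Sec F V₁) (x₂ : Sec F V₂)
      (e : res F (inf_le_left : V₁ ⊓ V₂ ≤ V₁) x₁ = res F (inf_le_right : V₁ ⊓ V₂ ≤ V₂) x₂) :
      ∃ p : Sec F (V₁ ⊔ V₂), res F le_sup_left p = x₁ ∧ res F le_sup_right p = x₂ := by
    obtain ⟨p, hp⟩ := exists_res_eq (F := F) hU hV (Bool.rec x₂ x₁) (by
      rintro (_ | _) (_ | _)
      · rfl
      · have e' := congrArg (res F (inf_comm V₁ V₂).ge) e
        rw [res_res, res_res] at e'
        exact e'.symm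
      · exact e
      · rfl)
    exact ⟨p, hp true, hp false⟩
  exact ⟨Coaction.IsTotalIntegral.exists_of_pullback (c.isComoduleHom_res le_sup_left)
      (c.isComoduleHom_res le_sup_right) (c.isComoduleHom_res inf_le_left)
      (c.isComoduleHom_res inf_le_right) (hF _) hex hinj hinjH hj₁ hj₂,
    Coaction.canLift_surjective_of_pullback (c.isComoduleHom_res le_sup_left)
      (c.isComoduleHom_res le_sup_right) (hF _) (hF _) hinjH hc₁ hc₂⟩

/-- Every `V` is the union of finitely many `V ∩ U i`, which are patched one after the other. -/
theorem isHopfGalois_of_isFlabby (hS : Function.Bijective (HopfAlgebra.antipode k : H →ₗ[k] H))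
    (hF : IsFlabby F) {ι : Type*} {U : ι → Opens X} (hfin : ∃ s : Finset ι, ⨆ i ∈ s, U i = ⊤)
    (hc : ∀ i, ∀ V ≤ U i, (c.on V).IsCleft) : c.IsHopfGalois := by
  classical
  obtain ⟨s, hs⟩ := hfin
  intro V
  have h (s : Finset ι) : (c.on (V ⊓ ⨆ i ∈ s, U i)).IsPatchable := by
    induction s using Finset.induction_on with
    | empty =>
      have h : V ⊓ ⨆ i ∈ (∅ : Finset ι), U i = ⊥ := by simp
      rw [h]
      exact c.isPatchable_bot
    | insert a s ha ih =>
      rw [Finset.iSup_insert, inf_sup_left]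
      exact c.isPatchable_sup hF (hc a _ inf_le_right).isPatchable ih
  have hV := h s
  rw [hs, inf_top_eq] at hV
  obtain ⟨⟨j, hj⟩, hcan⟩ := hV
  exact hj.isHopfGalois hS hcan

end SheafCoaction

end Flabby

/-! ### The principal coaction of a quantum principal bundle -/

section PrincipalCoaction

open CrossedSystem

variable {k : Type v} [Field k] {X : TopCat.{u}}
variable {H : Type w} [Ring H] [HopfAlgebra k H]

theorem Coaction.eq_of_δ {P : Type*} [Ring P] [Algebra k P] {c d : Coaction k H P}
    (h : ∀ p, c.δ p = d.δ p) : c = d := by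
  obtain ⟨δ, h1, h2⟩ := c
  obtain ⟨δ', h1', h2'⟩ := d
  obtain rfl : δ = δ' := AlgHom.ext h
  rfl

namespace QuantumPrincipalBundle

variable {M P : X.Sheaf (AlgCat.{u} k)} {ι : Type t} {U : ι → Opens X}
  (Q : QuantumPrincipalBundle H M P U)

theorem isTrivialization (i : ι) (V : Opens X) (hV : V ≤ U i) :
    (Q.cross i V hV).IsTrivialization (onSec Q.σ V) (Q.Ω i V hV) :=
  ⟨Q.Ω_mul i V hV, Q.Ω_tmul_one i V hV⟩

/-- The coaction on `P(V)` defined by the trivialization over `U i`. -/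
def localCoaction (i : ι) (V : Opens X) (hV : V ≤ U i) : Coaction k H (Sec P V) :=
  (Q.isTrivialization i V hV).coaction

theorem localCoaction_δ (i : ι) (V : Opens X) (hV : V ≤ U i) (x : Sec M V ⊗[k] H) :
    (Q.localCoaction i V hV).δ (Q.Ω i V hV x) =
      (Q.Ω i V hV).toLinearMap.rTensor H (freeCoaction k H (Sec M V) x) := by
  rw [localCoaction, IsTrivialization.coaction_δ, LinearEquiv.symm_apply_apply]

theorem localCoaction_res (i : ι) {V W : Opens X} (hV : V ≤ U i) (hWV : W ≤ V) (p : Sec P V) :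
    (Q.localCoaction i W (hWV.trans hV)).δ (res P hWV p) =
      (res P hWV).toLinearMap.rTensor H ((Q.localCoaction i V hV).δ p) := by
  obtain ⟨x, rfl⟩ := (Q.Ω i V hV).surjective p
  have h : (Q.Ω i W (hWV.trans hV)).toLinearMap ∘ₗ (res M hWV).toLinearMap.rTensor H =
      (res P hWV).toLinearMap ∘ₗ (Q.Ω i V hV).toLinearMap :=
    LinearMap.ext fun x => (Q.res_Ω i hV hWV x).symm
  rw [Q.res_Ω, localCoaction_δ, localCoaction_δ, Coaction.freeCoaction_rTensor,
    ← LinearMap.rTensor_comp_apply, ← LinearMap.rTensor_comp_apply, h]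

/-- The local coactions do not depend on `i` because the coordinate changes are colinear. -/
theorem localCoaction_eq (i j : ι) (V : Opens X) (hi : V ≤ U i) (hj : V ≤ U j) (p : Sec P V) :
    (Q.localCoaction i V hi).δ p = (Q.localCoaction j V hj).δ p := by
  obtain ⟨x, rfl⟩ := (Q.Ω j V hj).surjective p
  have h1 : Q.Ω j V hj x = Q.Ω i V hi (((Q.Ω j V hj).trans (Q.Ω i V hi).symm) x) := by simp
  have h2 : (Q.Ω i V hi).toLinearMap ∘ₗ ((Q.Ω j V hj).trans (Q.Ω i V hi).symm).toLinearMap =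
      (Q.Ω j V hj).toLinearMap := by
    ext x
    simp
  rw [Q.localCoaction_δ j, h1, Q.localCoaction_δ i, ← Q.Ω_colinear i j V hi hj x,
    ← LinearMap.rTensor_comp_apply, h2]

theorem exists_principalCoaction (hS : Function.Bijective (HopfAlgebra.antipode k : H →ₗ[k] H))
    (hfin : ∃ s : Finset ι, ⨆ i ∈ s, U i = ⊤) (hP : IsFlabby P) :
    ∃ c : SheafCoaction H P, Q.IsPrincipalCoaction c ∧ c.IsHopfGalois ∧ c.IsLocallyCleft := by
  obtain ⟨c, hc⟩ := exists_sheafCoaction hfin Q.localCoaction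
    (fun i _ _ hV hWV p => Q.localCoaction_res i hV hWV p) Q.localCoaction_eq
  have hcleft (i : ι) (V : Opens X) (hV : V ≤ U i) : (c.on V).IsCleft := by
    rw [Coaction.eq_of_δ (hc i V hV)]
    exact (Q.isTrivialization i V hV).isCleft_coaction
  refine ⟨c, fun i V hV p => hc i V hV p, c.isHopfGalois_of_isFlabby hS hP hfin hcleft, ?_⟩
  -- the covering is reindexed by its members, to land in the universe of `X`
  refine ⟨{V : Opens X // ∃ i, V = U i}, Subtype.val, ?_, ?_⟩
  · refine top_le_iff.1 (Q.cover.ge.trans (iSup_le fun i => ?_))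
    exact le_iSup (Subtype.val : {V : Opens X // ∃ i, V = U i} → Opens X) ⟨U i, i, rfl⟩
  · rintro ⟨_, i, rfl⟩
    exact hcleft i _ le_rfl

end QuantumPrincipalBundle

end PrincipalCoaction

/-! ### The sheaf of coinvariants -/

namespace SheafCoaction

variable {k : Type v} [Field k] {X : TopCat.{u}}
variable {H : Type w} [Ring H] [HopfAlgebra k H] {F : X.Sheaf (AlgCat.{u} k)}
  (c : SheafCoaction H F)

theorem res_mem_coinvariants {V W : Opens X} (h : W ≤ V) {p : Sec F V}
    (hp : p ∈ (c.on V).coinvariants) : res F h p ∈ (c.on W).coinvariants := by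
  rw [Coaction.mem_coinvariants_iff] at hp ⊢
  rw [c.res_δ, hp]
  simp

/-- The restriction map on coinvariants. -/
def coinvariantsRes {V W : Opens X} (h : W ≤ V) :
    (c.on V).coinvariants →ₐ[k] (c.on W).coinvariants :=
  ((res F h).comp (c.on V).coinvariants.val).codRestrict _
    fun p => c.res_mem_coinvariants h p.2

/-- The presheaf of coinvariants. -/
def coinvariantsPresheaf : TopCat.Presheaf (AlgCat.{u} k) X where
  obj V := AlgCat.of k (c.on V.unop).coinvariants
  map f := AlgCat.ofHom (c.coinvariantsRes f.unop.le)
  map_id _ := AlgCat.hom_ext _ (AlgHom.ext fun p => Subtype.ext (res_self F le_rfl p.1))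
  map_comp f g := AlgCat.hom_ext _
    (AlgHom.ext fun p => Subtype.ext (res_res F f.unop.le g.unop.le p.1).symm)

/-- A section glued from coinvariants is coinvariant, as `V ↦ F(V) ⊗ H` is separated. -/
theorem coinvariantsPresheaf_isSheaf : c.coinvariantsPresheaf.IsSheaf := by
  rw [TopCat.Presheaf.isSheaf_iff_isSheafUniqueGluing]
  intro ι U s hs
  have hU (i : ι) : U i ≤ iSup U := le_iSup U i
  obtain ⟨q, hq⟩ := exists_res_eq (F := F) hU le_rfl (fun i => (s i).1)
    fun i j => congrArg Subtype.val (hs i j)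
  have hmem : q ∈ (c.on (iSup U)).coinvariants := by
    rw [Coaction.mem_coinvariants_iff]
    refine tensor_ext hU le_rfl fun i => ?_
    have h1 : (c.on (U i)).δ (s i).1 = Coaction.incl k H _ (s i).1 := (s i).2
    rw [← c.res_δ, hq, h1, ← hq i]
    simp
  refine ⟨⟨q, hmem⟩, fun i => Subtype.ext (hq i), fun q' hq' => Subtype.ext ?_⟩
  refine sec_ext hU le_rfl fun i => ?_
  rw [hq]
  exact congrArg Subtype.val (hq' i)

/-- The sheaf of coinvariants. -/
def coinvariantsSheaf : X.Sheaf (AlgCat.{u} k) :=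
  ⟨c.coinvariantsPresheaf, c.coinvariantsPresheaf_isSheaf⟩

/-- The inclusion of the sheaf of coinvariants. -/
def coinvariantsIncl : c.coinvariantsSheaf ⟶ F :=
  ⟨{ app := fun V => AlgCat.ofHom (c.on V.unop).coinvariants.val
     naturality := fun _ _ _ => rfl }⟩

theorem onSec_coinvariantsIncl_injective (V : Opens X) :
    Function.Injective (onSec c.coinvariantsIncl V) := Subtype.val_injective

theorem range_onSec_coinvariantsIncl (V : Opens X) :
    (onSec c.coinvariantsIncl V).range = (c.on V).coinvariants :=
  Subalgebra.range_val _

end SheafCoaction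

/-! ### The bundle of a locally cleft sheaf of comodule algebras -/

namespace SheafCoaction

open WithConv CrossedSystem

variable {k : Type v} [Field k] {X : TopCat.{u}}
variable {H : Type w} [Ring H] [HopfAlgebra k H] {F : X.Sheaf (AlgCat.{u} k)}
  (c : SheafCoaction H F)

/-- The crossed systems and trivializations given by cleaving maps over the `U i` and their
restrictions form a quantum principal bundle. -/
theorem exists_quantumPrincipalBundle {M : X.Sheaf (AlgCat.{u} k)} (σ : M ⟶ F)
    (hσ : ∀ V, Function.Injective (onSec σ V))
    (hr : ∀ V, (onSec σ V).range = (c.on V).coinvariants) {ι : Type t} {U : ι → Opens X}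
    (hU : iSup U = ⊤) (hc : ∀ i, (c.on (U i)).IsCleft) :
    ∃ Q : QuantumPrincipalBundle H M F U, Q.σ = σ ∧ Q.IsPrincipalCoaction c := by
  choose γ hγ u hu using fun i => (hc i).exists_isTotalIntegral
  let g (i : ι) (V : Opens X) (hV : V ≤ U i) : WithConv (H →ₗ[k] Sec F V) :=
    convMap H (res F hV) (toConv (γ i))
  let g' (i : ι) (V : Opens X) (hV : V ≤ U i) : WithConv (H →ₗ[k] Sec F V) :=
    convMap H (res F hV) ↑(u i)⁻¹
  have h1 (i V hV) : g i V hV * g' i V hV = 1 := by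
    rw [← map_mul, ← hu, Units.mul_inv, map_one]
  have h2 (i V hV) : g' i V hV * g i V hV = 1 := by
    rw [← map_mul, ← hu, Units.inv_mul, map_one]
  have hg (i V hV) : (c.on V).IsTotalIntegral (g i V hV).ofConv :=
    ⟨(c.isComoduleHom_res hV).isColinear (hγ i).colinear,
      (congrArg (res F hV) (hγ i).map_one).trans (map_one _)⟩
  have hgres (i : ι) {V W : Opens X} (hV : V ≤ U i) (hWV : W ≤ V) :
      convMap H (res F hWV) (g i V hV) = g i W (hWV.trans hV) := by
    ext h
    exact res_res F _ _ _
  have hgres' (i : ι) {V W : Opens X} (hV : V ≤ U i) (hWV : W ≤ V) :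
      convMap H (res F hWV) (g' i V hV) = g' i W (hWV.trans hV) := by
    ext h
    exact res_res F _ _ _
  choose s Ω hΩ hact hcoc hΩ' hδ using fun (i : ι) (V : Opens X) (hV : V ≤ U i) =>
    (c.on V).exists_isTrivialization (hσ V) (hr V) (hg i V hV) (h1 i V hV) (h2 i V hV)
  let Q : QuantumPrincipalBundle H M F U :=
    { cover := hU
      σ := σ
      σ_injective := hσ
      cross := s
      res_act := fun i V W hV hWV h f => by
        have e := congrArg (convMap H (res F hWV)) (hact i V hV f)
        rw [map_mul, map_mul, convMap_convConst, hgres, hgres', ← onSec_res, ← hact] at e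
        refine hσ W ?_
        rw [onSec_res]
        exact congrArg (fun f : WithConv (H →ₗ[k] Sec F W) => f h) e
      res_coc := fun i V W hV hWV x => by
        have e := congrArg (convMap (H ⊗[k] H) (res F hWV)) (hcoc i V hV)
        rw [map_mul, map_mul, convMap_convComap, convMap_convComap, convMap_convComap, hgres,
          hgres', ← hcoc] at e
        refine hσ W ?_
        rw [onSec_res]
        exact congrArg (fun f : WithConv (H ⊗[k] H →ₗ[k] Sec F W) => f x) e
      Ω := Ω
      res_Ω := fun i V W hV hWV x => by
        induction x with
        | zero => simp
        | add x y hx hy => simp only [map_add, hx, hy]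
        | tmul a h =>
          rw [LinearMap.rTensor_tmul, hΩ', hΩ', map_mul, AlgHom.toLinearMap_apply, onSec_res,
            ← hgres i hV hWV]
          rfl
      Ω_mul := fun i V hV => (hΩ i V hV).map_mul
      Ω_tmul_one := fun i V hV => (hΩ i V hV).map_tmul_one
      Ω_colinear := fun i j V hi hj x => by
        have e : (Ω i V hi).toLinearMap.rTensor H
            (((Ω j V hj).trans (Ω i V hi).symm).toLinearMap.rTensor H
              (freeCoaction k H (Sec M V) x)) =
            (Ω i V hi).toLinearMap.rTensor H (freeCoaction k H (Sec M V)
              (((Ω j V hj).trans (Ω i V hi).symm) x)) := by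
          have e' : (Ω i V hi).toLinearMap ∘ₗ ((Ω j V hj).trans (Ω i V hi).symm).toLinearMap =
              (Ω j V hj).toLinearMap := by
            ext x
            simp
          rw [← LinearMap.rTensor_comp_apply, e', ← hδ, ← hδ]
          simp
        exact (LinearEquiv.rTensor H (Ω i V hi)).injective e }
  refine ⟨Q, rfl, fun i V hV p => ?_⟩
  have e := hδ i V hV ((Ω i V hV).symm p)
  rwa [LinearEquiv.apply_symm_apply] at e

end SheafCoaction

end QPB

end

theorem mainTheorem4 (k : Type v) [Field k] (H : Type w) [Ring H] [HopfAlgebra k H]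
    (hS : Function.Bijective (HopfAlgebra.antipode k : H →ₗ[k] H))
    (X : TopCat.{u}) (P : X.Sheaf (AlgCat.{u} k)) :
    (∀ (M : X.Sheaf (AlgCat.{u} k)) (ι : Type t) (U : ι → TopologicalSpace.Opens X)
        (Q : QPB.QuantumPrincipalBundle H M P U),
        (∃ s : Finset ι, (⨆ i ∈ s, U i) = ⊤) → QPB.IsFlabby P →
        ∃ c : QPB.SheafCoaction H P,
          Q.IsPrincipalCoaction c ∧ c.IsHopfGalois ∧ c.IsLocallyCleft) ∧
    (∀ c : QPB.SheafCoaction H P, c.IsHopfGalois → c.IsLocallyCleft →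
        ∃ (M : X.Sheaf (AlgCat.{u} k)) (ι : Type u) (U : ι → TopologicalSpace.Opens X)
          (Q : QPB.QuantumPrincipalBundle H M P U),
          Q.IsPrincipalCoaction c ∧
          ∀ V : TopologicalSpace.Opens X,
            (QPB.onSec Q.σ V).range = (c.on V).coinvariants) := by
  refine ⟨fun M ι U Q hfin hP => Q.exists_principalCoaction hS hfin hP, ?_⟩
  rintro c - ⟨ι, U, hU, hc⟩
  obtain ⟨Q, hσ, hQ⟩ := c.exists_quantumPrincipalBundle c.coinvariantsIncl
    c.onSec_coinvariantsIncl_injective c.range_onSec_coinvariantsIncl hU hc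
  exact ⟨c.coinvariantsSheaf, ι, U, Q, hQ, fun V => hσ ▸ c.range_onSec_coinvariantsIncl V⟩
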